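/- **Setting.** Let $d\ge 2$ and let $U\subset\mathbb R^d$ be a bounded open set with Lebesgue measure $|U|$. Put $2_*=\frac{2d}{d+2}$ if $d\ge 3$, and let $2_*\in(1,2)$ be arbitrary but fixed if $d=2$. Let $C_0^\infty(U)$ be the smooth functions with compact support in $U$. Let $H^{1,2}(U)$ be the space of $u\in L^2(U)$ with weak gradient $\nabla u\in L^2(U,\mathbb R^d)$, with norm $\|u\|_{H^{1,2}(U)}=\big(\|u\|_{L^2(U)}^2+\sum_{i}\|\partial_iu\|_{L^2(U)}^2\big)^{1/2}$, and let $H^{1,2}_0(U)$ be the closure of $C_0^\infty(U)$ in $H^{1,2}(U)$, with the same norm. For a vector field $G$, $\|G\|_{L^2(U)}$ is the $L^2$-norm of its pointwise Euclidean norm. Fix $\lambda>0$. Coefficients $(A,B,c)$ on $U$ are called *admissible* if $A=(a_{ij})$ is a (possibly non-symmetric) $d\times d$ matrix of functions in $L^\infty(U)$ with $\langle A(x)\xi,\xi\rangle\ge\lambda\|\xi\|^2$ for all $\xi\in\mathbb R^d$ and a.e. $x\in U$; $B\in L^2(U,\mathbb R^d)$ with $\operatorname{div}B\le 0$ weakly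 in $U$, i.e. $\int_U\langle B,\nabla\varphi\rangle\,dx\ge 0$ for all $\varphi\in C_0^\infty(U)$ with $\varphi\ge0$; and $c\in L^{2_*}(U)$ with $c\ge 0$ a.e. For $\alpha\ge0$, a *weak solution* with data $(A,B,c,f,F)$ is a function $u\in H^{1,2}_0(U)$ such that for every $\varphi\in C_0^\infty(U)$ $$\int_U\langle A\nabla u,\nabla\varphi\rangle+\big(\langle B,\nabla u\rangle+(c+\alpha)u\big)\varphi\,dx=\int_U f\varphi+\langle F,\nabla\varphi\rangle\,dx,$$ where both integrands are integrable. This is the weak form of $-\operatorname{div}(A\nabla u)+\langle B,\nabla u\rangle+(c+\alpha)u=f-\operatorname{div}F$ in $U$, $u=0$ on $\partial U$. **Corollary 1.2 ($L^1$-stability).** There is a constant $C_1>0$, depending only on $\lambda$, $d$, $|U|$ (and on the fixed number $2_*$ if $d=2$), with the following two properties. *Energy estimate.* For all admissible $(A,B,c)$, all $\alpha\ge0$, $f\in L^{2_*}(U)$, $F\in L^2(U,\mathbb R^d)$, every weak solution $u$ satisfies $\|u\|_{H^{1,2}_0(U)}\le C_1\big(\|f\|_{L^{2_*}(U)}+\|F\|_{L^2(U)}\big)$.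 *Stability.* Let $\alpha>0$, let $(A,B,c)$ and $(A_n,B_n,c_n)$, $n\ge1$, be admissible (with the same $\lambda$), let $f,f_n\in L^1(U)$ and $F,F_n\in L^2(U,\mathbb R^d)$, let $u$ be a weak solution with data $(A,B,c,f,F)$ and, for each $n$, let $u_n$ be a weak solution with data $(A_n,B_n,c_n,f_n,F_n)$ (and the same $\alpha$). Then for every $n\ge1$ $$\begin{aligned}\|u_n-u\|_{L^1(U)}\le{}&\alpha^{-1}C_4\Big(\|B-B_n\|_{L^2(U)}+N\|c-c_n\|_{L^{2_*}(U)}\Big)+C_3\|(A_n-A)\nabla u\|_{L^2(U)}\\&+\alpha^{-1}\|f-f_n\|_{L^1(U)}+C_3\|F-F_n\|_{L^2(U)},\end{aligned}$$ where $C_4=C_1\big(\|f\|_{L^{2_*}(U)}+\|F\|_{L^2(U)}\big)$ (which is $+\infty$ if $f\notin L^{2_*}(U)$, with $\infty\cdot0=0$), $C_3=|U|^{1/2}C_1$, and $N=\frac{2(d-1)}{d-2}$ if $d\ge3$, $N=\frac{2^*}{2}|U|^{1/2^*}$ with $2^*=\frac{2_*}{2_*-1}$ if $d=2$. In particular (also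 when $f\notin L^{2_*}(U)$), if for some $M>0$ the entries satisfy $\max_{i,j}\|a^n_{ij}\|_{L^\infty(U)}\le M$ for all $n$, $a^n_{ij}\to a_{ij}$ a.e. in $U$ for all $i,j$, $B_n\to B$ and $F_n\to F$ in $L^2(U,\mathbb R^d)$, $c_n\to c$ in $L^{2_*}(U)$ and $f_n\to f$ in $L^1(U)$, then $u_n\to u$ in $L^1(U)$. -/

import Mathlib

open MeasureTheory Filter Topology
open scoped ENNReal NNReal ContDiff

noncomputable section

/-- `d`-dimensional Euclidean space with the Euclidean norm. -/
abbrev Euc (d : ℕ) : Type := EuclideanSpace ℝ (Fin d)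

/-- The Lebesgue measure on `U`. All spaces `L^p(U)` are taken with respect to it. -/
abbrev lebOn {d : ℕ} (U : Set (Euc d)) : Measure (Euc d) := volume.restrict U

/-- `C_0^∞(U)`: smooth functions with compact support contained in the open set `U`
(extended by zero to the whole space). -/
structure IsTestFun {d : ℕ} (U : Set (Euc d)) (φ : Euc d → ℝ) : Prop where
  smooth : ContDiff ℝ ∞ φ
  compact : HasCompactSupport φ
  support : tsupport φ ⊆ U

/-- `g` is the weak gradient of `u` on `U`: for each `i` and each test function `φ`,
`∫_U u ∂_i φ dx = - ∫_U g_i φ dx`. -/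
structure HasWeakGrad {d : ℕ} (U : Set (Euc d)) (u : Euc d → ℝ) (g : Euc d → Euc d) : Prop where
  locInt : LocallyIntegrableOn u U
  locInt_grad : LocallyIntegrableOn g U
  parts : ∀ φ : Euc d → ℝ, IsTestFun U φ → ∀ i : Fin d,
    ∫ x in U, u x * (gradient φ x) i = - ∫ x in U, (g x) i * φ x

open Classical in
/-- The weak gradient `∇u` of `u` on `U` (unique up to null sets); it is `0` by convention for a
function that has no weak gradient. -/
def weakGrad {d : ℕ} (U : Set (Euc d)) (u : Euc d → ℝ) : Euc d → Euc d :=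
  if h : ∃ g, HasWeakGrad U u g then h.choose else 0

/-- `u ∈ H^{1,2}(U)`: `u ∈ L²(U)` has a weak gradient on `U`, which lies in `L²(U, ℝ^d)`. -/
structure MemH12 {d : ℕ} (U : Set (Euc d)) (u : Euc d → ℝ) : Prop where
  memLp : MemLp u 2 (lebOn U)
  exists_grad : ∃ g, HasWeakGrad U u g
  grad_memLp : MemLp (weakGrad U u) 2 (lebOn U)

/-- The norm `(‖u‖²_{L²(U)} + ∑ i, ‖∂_i u‖²_{L²(U)})^{1/2}` of `H^{1,2}(U)`. -/
def normH12 {d : ℕ} (U : Set (Euc d)) (u : Euc d → ℝ) : ℝ≥0∞ :=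
  (eLpNorm u 2 (lebOn U) ^ 2
    + ∑ i : Fin d, eLpNorm (fun x => (weakGrad U u x) i) 2 (lebOn U) ^ 2) ^ (1 / 2 : ℝ)

/-- `u ∈ H^{1,2}_0(U)`: `u` is in the closure of `C_0^∞(U)` in `H^{1,2}(U)`. -/
structure MemH12Zero {d : ℕ} (U : Set (Euc d)) (u : Euc d → ℝ) : Prop where
  memH12 : MemH12 U u
  approx : ∃ φ : ℕ → Euc d → ℝ, (∀ k, IsTestFun U (φ k)) ∧
    Tendsto (fun k => normH12 U (fun x => φ k x - u x)) atTop (𝓝 0)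

/-- The product of a matrix and a Euclidean vector. -/
def matVec {d : ℕ} (M : Matrix (Fin d) (Fin d) ℝ) (v : Euc d) : Euc d :=
  WithLp.toLp 2 (M.mulVec v.ofLp)

/-- The integrand `⟨A∇u, ∇φ⟩ + (⟨B, ∇u⟩ + (c + α) u) φ`. -/
def lhsIntegrand {d : ℕ} (U : Set (Euc d)) (A : Euc d → Matrix (Fin d) (Fin d) ℝ)
    (B : Euc d → Euc d) (c : Euc d → ℝ) (α : ℝ) (u φ : Euc d → ℝ) (x : Euc d) : ℝ :=
  inner ℝ (matVec (A x) (weakGrad U u x)) (gradient φ x)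
    + (inner ℝ (B x) (weakGrad U u x) + (c x + α) * u x) * φ x

/-- The integrand `f φ + ⟨F, ∇φ⟩`. -/
def rhsIntegrand {d : ℕ} (f : Euc d → ℝ) (F : Euc d → Euc d) (φ : Euc d → ℝ) (x : Euc d) : ℝ :=
  f x * φ x + inner ℝ (F x) (gradient φ x)

/-- `u` is a weak solution of
`-div(A∇u) + ⟨B, ∇u⟩ + (c + α) u = f - div F` in `U`, `u = 0` on `∂U`. -/
structure IsWeakSol {d : ℕ} (U : Set (Euc d)) (A : Euc d → Matrix (Fin d) (Fin d) ℝ)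
    (B : Euc d → Euc d) (c : Euc d → ℝ) (α : ℝ) (f : Euc d → ℝ) (F : Euc d → Euc d)
    (u : Euc d → ℝ) : Prop where
  memH12Zero : MemH12Zero U u
  integrable_lhs : ∀ φ, IsTestFun U φ → Integrable (lhsIntegrand U A B c α u φ) (lebOn U)
  integrable_rhs : ∀ φ, IsTestFun U φ → Integrable (rhsIntegrand f F φ) (lebOn U)
  eqn : ∀ φ, IsTestFun U φ →
    ∫ x in U, lhsIntegrand U A B c α u φ x = ∫ x in U, rhsIntegrand f F φ x

/-- `p` is an admissible value of `2_*` in dimension `d ≥ 2`: `2d/(d+2)` if `d ≥ 3`,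
any number in `(1,2)` if `d = 2`. -/
def IsTwoLowerStar (d : ℕ) (p : ℝ) : Prop :=
  (3 ≤ d ∧ p = 2 * (d : ℝ) / ((d : ℝ) + 2)) ∨ (d = 2 ∧ 1 < p ∧ p < 2)

/-- The constant `N`: `2(d-1)/(d-2)` if `d ≥ 3`, and `(q/2) V^{1/q}` with `q = p/(p-1)` if `d = 2`.
Here `p` stands for `2_*` and `V` for the volume of `U`. -/
def constN (d : ℕ) (p V : ℝ) : ℝ :=
  if 3 ≤ d then 2 * ((d : ℝ) - 1) / ((d : ℝ) - 2)
  else (p / (p - 1)) / 2 * V ^ (1 / (p / (p - 1)))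

/-- The assumptions on the domain and the coefficients: `U` is bounded and open, `A` has entries in
`L^∞(U)` and is elliptic with constant `lam`, `B ∈ L²(U, ℝ^d)` with `div B ≤ 0` weakly in `U`, and
`c ∈ L^p(U)` with `c ≥ 0`, where `p` stands for `2_*`. -/
structure Admissible {d : ℕ} (lam p : ℝ) (U : Set (Euc d)) (A : Euc d → Matrix (Fin d) (Fin d) ℝ)
    (B : Euc d → Euc d) (c : Euc d → ℝ) : Prop where
  isOpen : IsOpen U
  bounded : Bornology.IsBounded U
  A_memLp : ∀ i j, MemLp (fun x => A x i j) ∞ (lebOn U)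
  A_elliptic : ∀ᵐ x ∂(lebOn U), ∀ ξ : Euc d, lam * ‖ξ‖ ^ 2 ≤ inner ℝ (matVec (A x) ξ) ξ
  B_memLp : MemLp B 2 (lebOn U)
  B_div : ∀ φ, IsTestFun U φ → (∀ x, 0 ≤ φ x) → 0 ≤ ∫ x in U, inner ℝ (B x) (gradient φ x)
  c_memLp : MemLp c (ENNReal.ofReal p) (lebOn U)
  c_nonneg : ∀ᵐ x ∂(lebOn U), 0 ≤ c x

/-- `C₁` is a constant in the energy estimate
`‖u‖_{H^{1,2}_0(U)} ≤ C₁ (‖f‖_{L^p(U)} + ‖F‖_{L²(U)})` for the weak solutions on all domains of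
volume `V`, for all admissible coefficients with ellipticity constant `lam` and all `α ≥ 0`. -/
def IsEnergyConst (d : ℕ) (p lam : ℝ) (V : ℝ≥0) (C₁ : ℝ) : Prop :=
  ∀ (U : Set (Euc d)) (A : Euc d → Matrix (Fin d) (Fin d) ℝ) (B : Euc d → Euc d)
    (c : Euc d → ℝ) (α : ℝ) (f : Euc d → ℝ) (F : Euc d → Euc d) (u : Euc d → ℝ),
    volume U = (V : ℝ≥0∞) → Admissible lam p U A B c → 0 ≤ α →
    MemLp f (ENNReal.ofReal p) (lebOn U) → MemLp F 2 (lebOn U) →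
    IsWeakSol U A B c α f F u →
    normH12 U u ≤ ENNReal.ofReal C₁ *
      (eLpNorm f (ENNReal.ofReal p) (lebOn U) + eLpNorm F 2 (lebOn U))

end

/-! The difference $u_n-u$ solves the equation with coefficients $(A_n,B_n,c_n)$ and data
$f_n-f+\langle B-B_n,\nabla u\rangle+(c-c_n)u\in L^1$, $F_n-F-(A_n-A)\nabla u\in L^2$. Stability
therefore reduces to Hölder's inequality and an $L^1$ bound for a single equation,
`IsWeakSol.eLpNorm_one_le_add`.

Since $\langle B,\nabla u\rangle$ is merely integrable, $u$ itself need not be a legitimate test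
function. The equation is tested with $\psi_\varepsilon(u)=u/\sqrt{1+\varepsilon u^2}$, a bounded
smooth increasing function of $u$. The drift term becomes $\int\langle
B,\nabla\Psi_\varepsilon(u)\rangle$ with the nonnegative primitive $\Psi_\varepsilon$ of
$\psi_\varepsilon$, and is nonnegative because $\operatorname{div}B\le0$; the term with $c$ is
nonnegative by sign. The resulting inequality, `IsWeakSol.softId_inequality`, is used at both ends.
As $\varepsilon\to0$ it gives the energy inequality, which together with Sobolev's inequality yields
$C_1$. As $\varepsilon\to\infty$, $\sqrt\varepsilon\,\psi_\varepsilon$ tends to the sign function,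
which gives $\alpha\|u\|_{L^1}\le\|f\|_{L^1}$ when $F=0$.

A nonzero $F$ is removed by subtracting a solution $z$ with data $(0,F)$. It exists by a Lions
projection argument, `exists_inner_eq_of_coercive`, and $\|z\|_{L^1}\le|U|^{1/2}\|z\|_{L^2}$ is
controlled by the energy estimate.

The constant $C_1$ is taken so large that $NC_1$ also bounds the $L^{2^*}$ norm of solutions. The
final convergence uses the variant `IsWeakSol.eLpNorm_sub_le`, whose factors $\|\nabla u\|_{L^2}$
and $\|u\|_{L^{2^*}}$ are finite even if $f\notin L^{2_*}$. -/

/-! ### Calculus of test functions. -/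

section TestFunctions

variable {d : ℕ} {U : Set (Euc d)} {φ ψ : Euc d → ℝ}

lemma gradient_apply_eq_fderiv (φ : Euc d → ℝ) (x : Euc d) (i : Fin d) :
    gradient φ x i = fderiv ℝ φ x (EuclideanSpace.single i 1) := by
  rw [← inner_gradient_left, EuclideanSpace.inner_single_right]
  simp

lemma norm_gradient_eq (φ : Euc d → ℝ) (x : Euc d) : ‖gradient φ x‖ = ‖fderiv ℝ φ x‖ := by
  simp [gradient]

namespace IsTestFun

lemma continuous_gradient (h : IsTestFun U φ) : Continuous (gradient φ) :=
  (InnerProductSpace.toDual ℝ (Euc d)).symm.continuous.comp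
    (h.smooth.continuous_fderiv (by simp))

lemma hasCompactSupport_gradient (h : IsTestFun U φ) : HasCompactSupport (gradient φ) :=
  (h.compact.fderiv (𝕜 := ℝ)).comp_left (map_zero (InnerProductSpace.toDual ℝ (Euc d)).symm)

lemma differentiableAt (h : IsTestFun U φ) (x : Euc d) : DifferentiableAt ℝ φ x :=
  h.smooth.contDiffAt.differentiableAt (by simp)

lemma eq_zero_of_notMem (h : IsTestFun U φ) {x : Euc d} (hx : x ∉ U) : φ x = 0 :=
  image_eq_zero_of_notMem_tsupport fun hx' => hx (h.support hx')

lemma gradient_eq_zero_of_notMem (h : IsTestFun U φ) {x : Euc d} (hx : x ∉ U) :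
    gradient φ x = 0 := by
  rw [← norm_eq_zero, norm_gradient_eq, norm_eq_zero]
  exact image_eq_zero_of_notMem_tsupport fun hx' =>
    hx (h.support (tsupport_fderiv_subset ℝ hx'))

lemma memLp (h : IsTestFun U φ) (p : ℝ≥0∞) (μ : Measure (Euc d)) [IsFiniteMeasureOnCompacts μ] :
    MemLp φ p μ :=
  h.smooth.continuous.memLp_of_hasCompactSupport h.compact

lemma gradient_memLp (h : IsTestFun U φ) (p : ℝ≥0∞) (μ : Measure (Euc d))
    [IsFiniteMeasureOnCompacts μ] : MemLp (gradient φ) p μ :=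
  h.continuous_gradient.memLp_of_hasCompactSupport h.hasCompactSupport_gradient

lemma exists_bound (h : IsTestFun U φ) : ∃ C, ∀ x, ‖φ x‖ ≤ C :=
  h.compact.exists_bound_of_continuous h.smooth.continuous

/-- Lets nonlinear functions of a solution be tested through its approximants, so that no chain rule
for weak gradients is needed. -/
lemma comp (h : IsTestFun U φ) {η : ℝ → ℝ} (hη : ContDiff ℝ ∞ η) (h0 : η 0 = 0) :
    IsTestFun U (fun x => η (φ x)) where
  smooth := hη.comp h.smooth
  compact := h.compact.comp_left h0
  support := (closure_mono (Function.support_comp_subset h0 φ)).trans h.support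

lemma gradient_comp (h : IsTestFun U φ) {η : ℝ → ℝ} (hη : ContDiff ℝ ∞ η) (x : Euc d) :
    gradient (fun x => η (φ x)) x = deriv η (φ x) • gradient φ x := by
  have h1 : HasDerivAt η (deriv η (φ x)) (φ x) :=
    (hη.differentiable (by simp)).differentiableAt.hasDerivAt
  have h2 := h1.comp_hasFDerivAt x (h.differentiableAt x).hasFDerivAt
  have h3 : fderiv ℝ (fun x => η (φ x)) x = deriv η (φ x) • fderiv ℝ φ x := h2.fderiv
  simp [gradient, h3]

protected lemma add (h : IsTestFun U φ) (h' : IsTestFun U ψ) : IsTestFun U (φ + ψ) where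
  smooth := h.smooth.add h'.smooth
  compact := h.compact.add h'.compact
  support := (tsupport_add φ ψ).trans (Set.union_subset h.support h'.support)

lemma const_smul (h : IsTestFun U φ) (a : ℝ) : IsTestFun U (a • φ) where
  smooth := h.smooth.const_smul a
  compact := h.compact.comp_left (g := fun t => a * t) (mul_zero a)
  support := (closure_mono (Function.support_comp_subset (g := fun t => a * t)
    (mul_zero a) φ)).trans h.support

lemma gradient_add (h : IsTestFun U φ) (h' : IsTestFun U ψ) (x : Euc d) :
    gradient (φ + ψ) x = gradient φ x + gradient ψ x := by
  simp [gradient, fderiv_add (h.differentiableAt x) (h'.differentiableAt x)]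

lemma gradient_const_smul (h : IsTestFun U φ) (a : ℝ) (x : Euc d) :
    gradient (a • φ) x = a • gradient φ x := by
  simp [gradient, fderiv_const_smul (h.differentiableAt x)]

lemma zero : IsTestFun U (0 : Euc d → ℝ) where
  smooth := contDiff_const
  compact := HasCompactSupport.zero
  support := by simp [tsupport]

/-- Integration by parts for two test functions. -/
lemma integral_mul_gradient (h : IsTestFun U φ) (h' : IsTestFun U ψ) (i : Fin d) :
    ∫ x in U, φ x * gradient ψ x i = - ∫ x in U, gradient φ x i * ψ x := by
  rw [setIntegral_eq_integral_of_forall_compl_eq_zero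
      (fun x hx => by simp [h.eq_zero_of_notMem hx]),
    setIntegral_eq_integral_of_forall_compl_eq_zero
      (fun x hx => by simp [h'.eq_zero_of_notMem hx])]
  have hc : ∀ {f g : Euc d → ℝ}, IsTestFun U f → IsTestFun U g →
      Integrable (fun x => fderiv ℝ f x (EuclideanSpace.single i 1) * g x) := by
    intro f g hf hg
    simp only [← gradient_apply_eq_fderiv]
    refine Continuous.integrable_of_hasCompactSupport ?_ (hg.compact.mul_left)
    exact ((EuclideanSpace.proj i).continuous.comp hf.continuous_gradient).mul hg.smooth.continuous
  simp only [gradient_apply_eq_fderiv]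
  exact integral_mul_fderiv_eq_neg_fderiv_mul_of_integrable (hc h h')
    (by simpa only [mul_comm] using hc h' h)
    ((h.smooth.continuous.mul h'.smooth.continuous).integrable_of_hasCompactSupport
      h'.compact.mul_left)
    (fun x _ => h.differentiableAt x) (fun x _ => h'.differentiableAt x)

lemma hasWeakGrad (h : IsTestFun U φ) : HasWeakGrad U φ (gradient φ) where
  locInt := h.smooth.continuous.locallyIntegrable.locallyIntegrableOn U
  locInt_grad := h.continuous_gradient.locallyIntegrable.locallyIntegrableOn U
  parts _ hψ i := h.integral_mul_gradient hψ i

end IsTestFun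

/-- For a function vanishing off `U`, the norm over `U` is the norm over the whole space. -/
lemma eLpNorm_lebOn_eq {E : Type*} [NormedAddCommGroup E] {f : Euc d → E}
    (hf : ∀ x, x ∉ U → f x = 0) (p : ℝ≥0∞) : eLpNorm f p (lebOn U) = eLpNorm f p volume :=
  eLpNorm_restrict_eq_of_support_subset fun x hx => by
    by_contra h
    exact hx (hf x h)

end TestFunctions

/-! ### Uniqueness of weak gradients. -/

section WeakGradient

variable {d : ℕ} {U : Set (Euc d)} {u v : Euc d → ℝ} {g g' : Euc d → Euc d}

lemma MeasureTheory.LocallyIntegrableOn.euc_apply (hg : LocallyIntegrableOn g U) (i : Fin d) :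
    LocallyIntegrableOn (fun x => g x i) U := fun x hx => by
  obtain ⟨s, hs, h⟩ := hg x hx
  exact ⟨s, hs, (EuclideanSpace.proj (𝕜 := ℝ) i).integrable_comp h⟩

/-- The fundamental lemma of the calculus of variations, applied to each component. As `weakGrad` is
an arbitrary choice, this is what identifies it in concrete cases. -/
lemma HasWeakGrad.ae_eq (hU : IsOpen U) (h : HasWeakGrad U u g) (h' : HasWeakGrad U u g') :
    g =ᵐ[lebOn U] g' := by
  have key : ∀ i, ∀ᵐ x ∂(lebOn U), g x i = g' x i := by
    intro i
    rw [ae_restrict_iff' hU.measurableSet]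
    have h1 := h.locInt_grad.euc_apply i
    have h2 := h'.locInt_grad.euc_apply i
    have := hU.ae_eq_zero_of_integral_contDiff_smul_eq_zero (μ := volume) (h1.sub h2) ?_
    · filter_upwards [this] with x hx hxU
      simpa [sub_eq_zero] using hx hxU
    · intro φ hφ hc hs
      have hT : IsTestFun U φ := ⟨hφ, hc, hs⟩
      have hi : ∀ {f : Euc d → ℝ}, LocallyIntegrableOn f U →
          Integrable (fun x => f x * φ x) := by
        intro f hf
        have h3 : IntegrableOn f (tsupport φ) := hf.integrableOn_compact_subset hs hc
        have h4 : IntegrableOn (fun x => f x * φ x) (tsupport φ) :=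
          h3.mul_continuousOn hφ.continuous.continuousOn hc
        exact (integrableOn_iff_integrable_of_support_subset
          ((Function.support_mul_subset_right _ _).trans (subset_tsupport φ))).1 h4
      have e1 := h.parts φ hT i
      have e2 := h'.parts φ hT i
      rw [e1, neg_inj] at e2
      rw [setIntegral_eq_integral_of_forall_compl_eq_zero
          (fun x hx => by simp [hT.eq_zero_of_notMem hx]),
        setIntegral_eq_integral_of_forall_compl_eq_zero
          (fun x hx => by simp [hT.eq_zero_of_notMem hx])] at e2
      have : ∀ x, φ x • ((fun x => g x i) - fun x => g' x i) x = g x i * φ x - g' x i * φ x := by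
        intro x; simp; ring
      simp only [this]
      rw [integral_sub (hi h1) (hi h2), e2, sub_self]
  filter_upwards [ae_all_iff.2 key] with x hx
  ext i
  exact hx i

lemma HasWeakGrad.hasWeakGrad_weakGrad (h : HasWeakGrad U u g) :
    HasWeakGrad U u (weakGrad U u) := by
  have : ∃ g, HasWeakGrad U u g := ⟨g, h⟩
  rw [weakGrad, dif_pos this]
  exact this.choose_spec

lemma HasWeakGrad.weakGrad_ae_eq (hU : IsOpen U) (h : HasWeakGrad U u g) :
    weakGrad U u =ᵐ[lebOn U] g :=
  h.hasWeakGrad_weakGrad.ae_eq hU h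

end WeakGradient

/-! ### Limits of integrals of products. -/

section Convergence

variable {X : Type*} [MeasurableSpace X] {μ : Measure X}
variable {H : Type*} [NormedAddCommGroup H] [InnerProductSpace ℝ H]

/-- Cauchy–Schwarz for the pointwise inner product. -/
lemma eLpNorm_inner_le {G g : X → H} (hG : AEStronglyMeasurable G μ)
    (hg : AEStronglyMeasurable g μ) :
    eLpNorm (fun x => inner ℝ (G x) (g x)) 1 μ ≤ eLpNorm G 2 μ * eLpNorm g 2 μ := by
  have := eLpNorm_le_eLpNorm_mul_eLpNorm'_of_norm (p := 2) (q := 2) (r := 1) hG hg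
    (fun a b => inner ℝ a b) 1 (Eventually.of_forall fun x => by
      simpa using norm_inner_le_norm (𝕜 := ℝ) (G x) (g x))
  simpa using this

lemma integrable_inner_of_memLp {G g : X → H} (hG : MemLp G 2 μ) (hg : MemLp g 2 μ) :
    Integrable (fun x => inner ℝ (G x) (g x)) μ :=
  memLp_one_iff_integrable.1 ⟨hG.1.inner hg.1,
    (eLpNorm_inner_le hG.1 hg.1).trans_lt (ENNReal.mul_lt_top hG.2 hg.2)⟩

lemma norm_integral_le_eLpNorm_one (f : X → ℝ) :
    ‖∫ x, f x ∂μ‖ₑ ≤ eLpNorm f 1 μ := by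
  rw [eLpNorm_one_eq_lintegral_enorm]
  exact enorm_integral_le_lintegral_enorm f

/-- Serves the terms where one factor is only in $L^1$, such as $\langle B,\nabla u\rangle$ or $f$.
-/
lemma tendsto_integral_mul_bdd {h b : X → ℝ} {bk : ℕ → X → ℝ} {K : ℝ} (hh : Integrable h μ)
    (hm : ∀ k, AEStronglyMeasurable (bk k) μ) (hb : ∀ k x, |bk k x| ≤ K)
    (hlim : ∀ᵐ x ∂μ, Tendsto (fun k => bk k x) atTop (𝓝 (b x))) :
    Tendsto (fun k => ∫ x, h x * bk k x ∂μ) atTop (𝓝 (∫ x, h x * b x ∂μ)) := by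
  refine tendsto_integral_of_dominated_convergence (fun x => ‖h x‖ * K)
    (fun k => hh.1.mul (hm k)) (hh.norm.mul_const K) (fun k => ?_) ?_
  · filter_upwards with x
    rw [norm_mul]
    exact mul_le_mul_of_nonneg_left (hb k x) (norm_nonneg _)
  · filter_upwards [hlim] with x hx
    exact hx.const_mul _

/-- Bounded a.e. convergence combines with strong `L²` convergence. -/
lemma tendsto_integral_mul_inner {G g : X → H} {gk : ℕ → X → H} {b : X → ℝ} {bk : ℕ → X → ℝ}
    {K : ℝ} (hG : MemLp G 2 μ) (hg : MemLp g 2 μ) (hgk : ∀ k, MemLp (gk k) 2 μ)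
    (hlimg : Tendsto (fun k => eLpNorm (fun x => gk k x - g x) 2 μ) atTop (𝓝 0))
    (hm : ∀ k, AEStronglyMeasurable (bk k) μ) (hb : ∀ k x, |bk k x| ≤ K)
    (hlim : ∀ᵐ x ∂μ, Tendsto (fun k => bk k x) atTop (𝓝 (b x))) :
    Tendsto (fun k => ∫ x, bk k x * inner ℝ (G x) (gk k x) ∂μ) atTop
      (𝓝 (∫ x, b x * inner ℝ (G x) (g x) ∂μ)) := by
  have hint : ∀ k, Integrable (fun x => bk k x * inner ℝ (G x) (gk k x - g x)) μ := fun k =>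
    (integrable_inner_of_memLp hG ((hgk k).sub hg)).bdd_mul (hm k)
      (Eventually.of_forall (hb k))
  have hint' : ∀ k, Integrable (fun x => inner ℝ (G x) (g x) * bk k x) μ := fun k =>
    (integrable_inner_of_memLp hG hg).mul_bdd (hm k) (Eventually.of_forall (hb k))
  -- The factor $g_k$ is split as $(g_k-g)+g$: the first part vanishes by Cauchy–Schwarz and the
  -- uniform bound $K$, the second converges by domination.
  have h1 : Tendsto (fun k => ∫ x, bk k x * inner ℝ (G x) (gk k x - g x) ∂μ) atTop (𝓝 0) := by
    rw [tendsto_zero_iff_enorm_tendsto_zero]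
    have hle : ∀ k, ‖∫ x, bk k x * inner ℝ (G x) (gk k x - g x) ∂μ‖ₑ ≤
        ENNReal.ofReal K * (eLpNorm G 2 μ * eLpNorm (fun x => gk k x - g x) 2 μ) := fun k => by
      refine (norm_integral_le_eLpNorm_one _).trans ?_
      refine (eLpNorm_le_mul_eLpNorm_of_ae_le_mul (c := K)
        (g := fun x => inner ℝ (G x) (gk k x - g x)) (Eventually.of_forall fun x => ?_) 1).trans ?_
      · rw [norm_mul]
        exact mul_le_mul_of_nonneg_right (hb k x) (norm_nonneg _)
      · gcongr
        exact eLpNorm_inner_le hG.1 ((hgk k).sub hg).1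
    have hz : Tendsto (fun k => ENNReal.ofReal K *
        (eLpNorm G 2 μ * eLpNorm (fun x => gk k x - g x) 2 μ)) atTop (𝓝 0) := by
      have := ENNReal.Tendsto.const_mul (a := ENNReal.ofReal K)
        (ENNReal.Tendsto.const_mul hlimg (Or.inr hG.2.ne)) (Or.inr ENNReal.ofReal_ne_top)
      simpa using this
    exact tendsto_of_tendsto_of_tendsto_of_le_of_le tendsto_const_nhds hz (fun _ => zero_le) hle
  have h2 := tendsto_integral_mul_bdd (integrable_inner_of_memLp hG hg) hm hb hlim
  have h3 := h1.add h2
  rw [zero_add] at h3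
  simp only [mul_comm (b _)]
  refine h3.congr fun k => ?_
  rw [← integral_add (hint k) (hint' k)]
  congr 1 with x
  rw [inner_sub_right]
  ring

lemma exists_subseq_ae_tendsto {E : Type*} [NormedAddCommGroup E] {f : ℕ → X → E} {g : X → E}
    (hf : ∀ k, AEStronglyMeasurable (f k) μ) (hg : AEStronglyMeasurable g μ)
    (h : Tendsto (fun k => eLpNorm (fun x => f k x - g x) 2 μ) atTop (𝓝 0)) :
    ∃ ns : ℕ → ℕ, StrictMono ns ∧ ∀ᵐ x ∂μ, Tendsto (fun k => f (ns k) x) atTop (𝓝 (g x)) :=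
  (tendstoInMeasure_of_tendsto_eLpNorm (by simp) hf hg h).exists_seq_tendsto_ae

end Convergence

/-! ### The space $H^{1,2}_0(U)$ through approximating test functions. -/

section Approximation

variable {d : ℕ} {U : Set (Euc d)} {u v : Euc d → ℝ} {g : Euc d → Euc d}

/-- The test functions `φ k` converge to `u`, and their gradients to `g`, in `L²(U)` and a.e. -/
structure TestApprox (U : Set (Euc d)) (u : Euc d → ℝ) (g : Euc d → Euc d)
    (φ : ℕ → Euc d → ℝ) : Prop where
  test : ∀ k, IsTestFun U (φ k)
  tendsto_fun : Tendsto (fun k => eLpNorm (fun x => φ k x - u x) 2 (lebOn U)) atTop (𝓝 0)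
  tendsto_grad :
    Tendsto (fun k => eLpNorm (fun x => gradient (φ k) x - g x) 2 (lebOn U)) atTop (𝓝 0)
  ae_fun : ∀ᵐ x ∂(lebOn U), Tendsto (fun k => φ k x) atTop (𝓝 (u x))
  ae_grad : ∀ᵐ x ∂(lebOn U), Tendsto (fun k => gradient (φ k) x) atTop (𝓝 (g x))

lemma exists_testApprox {φ : ℕ → Euc d → ℝ} (hu : MemLp u 2 (lebOn U)) (hg : MemLp g 2 (lebOn U))
    (hφ : ∀ k, IsTestFun U (φ k))
    (h1 : Tendsto (fun k => eLpNorm (fun x => φ k x - u x) 2 (lebOn U)) atTop (𝓝 0))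
    (h2 : Tendsto (fun k => eLpNorm (fun x => gradient (φ k) x - g x) 2 (lebOn U)) atTop (𝓝 0)) :
    ∃ φ', TestApprox U u g φ' := by
  obtain ⟨n1, hn1, ha1⟩ := exists_subseq_ae_tendsto
    (fun k => ((hφ k).memLp 2 (lebOn U)).1) hu.1 h1
  obtain ⟨n2, hn2, ha2⟩ := exists_subseq_ae_tendsto
    (fun k => ((hφ (n1 k)).gradient_memLp 2 (lebOn U)).1) hg.1 (h2.comp hn1.tendsto_atTop)
  refine ⟨fun k => φ (n1 (n2 k)), fun k => hφ _, ?_, ?_, ?_, ha2⟩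
  · exact h1.comp (hn1.comp hn2).tendsto_atTop
  · exact h2.comp (hn1.comp hn2).tendsto_atTop
  · filter_upwards [ha1] with x hx using hx.comp hn2.tendsto_atTop

lemma eLpNorm_two_sq {X E : Type*} [MeasurableSpace X] {μ : Measure X} [NormedAddCommGroup E]
    (f : X → E) : eLpNorm f 2 μ ^ 2 = ∫⁻ x, ‖f x‖ₑ ^ 2 ∂μ := by
  rw [eLpNorm_eq_lintegral_rpow_enorm_toReal (by simp) (by simp), ← ENNReal.rpow_natCast,
    ← ENNReal.rpow_mul]
  simp

/-- Reconciles the sum over partial derivatives in `normH12` with the $L^2$ norm of the Euclidean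
length. -/
lemma eLpNorm_euc_sq {μ : Measure (Euc d)} (hg : AEStronglyMeasurable g μ) :
    ∑ i : Fin d, eLpNorm (fun x => g x i) 2 μ ^ 2 = eLpNorm g 2 μ ^ 2 := by
  have hm : ∀ i, AEStronglyMeasurable (fun x => g x i) μ := fun i =>
    (EuclideanSpace.proj (𝕜 := ℝ) i).continuous.comp_aestronglyMeasurable hg
  simp_rw [eLpNorm_two_sq]
  rw [← lintegral_finsetSum' _ fun i _ => (hm i).enorm.pow_const 2]
  congr 1 with x
  rw [← ofReal_norm, ← ENNReal.ofReal_pow (norm_nonneg _), EuclideanSpace.norm_sq_eq,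
    ENNReal.ofReal_sum_of_nonneg fun _ _ => by positivity]
  refine Finset.sum_congr rfl fun i _ => ?_
  rw [← ofReal_norm, ← ENNReal.ofReal_pow (norm_nonneg _)]

lemma normH12_eq (h : AEStronglyMeasurable (weakGrad U u) (lebOn U)) :
    normH12 U u = (eLpNorm u 2 (lebOn U) ^ 2 + eLpNorm (weakGrad U u) 2 (lebOn U) ^ 2)
      ^ (1 / 2 : ℝ) := by
  rw [normH12, eLpNorm_euc_sq h]

lemma ennreal_le_sqrt_add_sq (a b : ℝ≥0∞) : a ≤ (a ^ 2 + b ^ 2) ^ (1 / 2 : ℝ) := by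
  calc a = (a ^ 2) ^ (1 / 2 : ℝ) := by
        rw [← ENNReal.rpow_natCast, ← ENNReal.rpow_mul]; norm_num
    _ ≤ _ := ENNReal.rpow_le_rpow le_self_add (by norm_num)

lemma ennreal_sqrt_add_sq_le (a b : ℝ≥0∞) : (a ^ 2 + b ^ 2) ^ (1 / 2 : ℝ) ≤ a + b := by
  calc (a ^ 2 + b ^ 2) ^ (1 / 2 : ℝ) ≤ ((a + b) ^ 2) ^ (1 / 2 : ℝ) := by
        refine ENNReal.rpow_le_rpow ?_ (by norm_num)
        calc a ^ 2 + b ^ 2 ≤ a ^ 2 + b ^ 2 + 2 * a * b := le_self_add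
          _ = (a + b) ^ 2 := by ring
    _ = a + b := by rw [← ENNReal.rpow_natCast, ← ENNReal.rpow_mul]; norm_num

lemma eLpNorm_le_normH12 (h : AEStronglyMeasurable (weakGrad U u) (lebOn U)) :
    eLpNorm u 2 (lebOn U) ≤ normH12 U u := by
  rw [normH12_eq h]; exact ennreal_le_sqrt_add_sq _ _

lemma eLpNorm_weakGrad_le_normH12 (h : AEStronglyMeasurable (weakGrad U u) (lebOn U)) :
    eLpNorm (weakGrad U u) 2 (lebOn U) ≤ normH12 U u := by
  rw [normH12_eq h, add_comm]; exact ennreal_le_sqrt_add_sq _ _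

lemma normH12_le (h : AEStronglyMeasurable (weakGrad U u) (lebOn U)) :
    normH12 U u ≤ eLpNorm u 2 (lebOn U) + eLpNorm (weakGrad U u) 2 (lebOn U) := by
  rw [normH12_eq h]; exact ennreal_sqrt_add_sq_le _ _

lemma MeasureTheory.MemLp.locallyIntegrableOn {E : Type*} [NormedAddCommGroup E] {f : Euc d → E}
    (hf : MemLp f 2 (lebOn U)) : LocallyIntegrableOn f U :=
  locallyIntegrableOn_of_locallyIntegrable_restrict (hf.locallyIntegrable (by norm_num))

/-- The weak gradient of a difference. -/
lemma HasWeakGrad.sub {gv : Euc d → Euc d} (h : HasWeakGrad U u g) (h' : HasWeakGrad U v gv)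
    (hu : MemLp u 2 (lebOn U)) (hv : MemLp v 2 (lebOn U)) (hg : MemLp g 2 (lebOn U))
    (hgv : MemLp gv 2 (lebOn U)) :
    HasWeakGrad U (fun x => u x - v x) (fun x => g x - gv x) where
  locInt := h.locInt.sub h'.locInt
  locInt_grad := h.locInt_grad.sub h'.locInt_grad
  parts φ hφ i := by
    have hi : ∀ i {f : Euc d → Euc d}, MemLp f 2 (lebOn U) → MemLp (fun x => f x i) 2 (lebOn U) :=
      fun i f hf => (EuclideanSpace.proj (𝕜 := ℝ) i).comp_memLp' hf
    have hm := hφ.memLp 2 (lebOn U)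
    have hm' := hi i (hφ.gradient_memLp 2 (lebOn U))
    simp only [sub_mul, PiLp.sub_apply]
    have e1 := integral_sub (hu.integrable_mul hm') (hv.integrable_mul hm')
    have e2 := integral_sub ((hi i hg).integrable_mul hm) ((hi i hgv).integrable_mul hm)
    simp only [Pi.mul_apply] at e1 e2
    rw [e1, e2, h.parts φ hφ i, h'.parts φ hφ i]
    ring

namespace TestApprox

variable {φ : ℕ → Euc d → ℝ}

/-- Both sides of the integration by parts formula are $L^2$ pairings with a fixed function, hence
pass to the limit. -/
lemma hasWeakGrad (h : TestApprox U u g φ) (hu : MemLp u 2 (lebOn U))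
    (hg : MemLp g 2 (lebOn U)) : HasWeakGrad U u g where
  locInt := hu.locallyIntegrableOn
  locInt_grad := hg.locallyIntegrableOn
  parts ψ hψ i := by
    have hi : ∀ {f : Euc d → Euc d}, MemLp f 2 (lebOn U) → MemLp (fun x => f x i) 2 (lebOn U) :=
      fun hf => (EuclideanSpace.proj (𝕜 := ℝ) i).comp_memLp' hf
    have h1 : Tendsto (fun k => ∫ x in U, φ k x * gradient ψ x i) atTop
        (𝓝 (∫ x in U, u x * gradient ψ x i)) := by
      have := tendsto_integral_mul_inner (b := fun _ => 1) (bk := fun _ _ => 1) (K := 1)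
        (hi (hψ.gradient_memLp 2 (lebOn U))) hu (fun k => (h.test k).memLp 2 _) h.tendsto_fun
        (fun k => aestronglyMeasurable_const) (by simp) (by simp)
      simpa using this
    have h2 : Tendsto (fun k => ∫ x in U, gradient (φ k) x i * ψ x) atTop
        (𝓝 (∫ x in U, g x i * ψ x)) := by
      have h3 : Tendsto (fun k => eLpNorm (fun x => gradient (φ k) x i - g x i) 2 (lebOn U))
          atTop (𝓝 0) := by
        refine tendsto_of_tendsto_of_tendsto_of_le_of_le tendsto_const_nhds h.tendsto_grad
          (fun _ => zero_le) (fun k => eLpNorm_mono fun x => ?_)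
        exact PiLp.norm_apply_le (gradient (φ k) x - g x) i
      have := tendsto_integral_mul_inner (b := fun _ => 1) (bk := fun _ _ => 1) (K := 1)
        (hψ.memLp 2 (lebOn U)) (hi hg) (fun k => hi ((h.test k).gradient_memLp 2 _)) h3
        (fun k => aestronglyMeasurable_const) (by simp) (by simp)
      simpa using this
    refine tendsto_nhds_unique h1 ?_
    simpa only [(h.test _).integral_mul_gradient hψ i] using h2.neg

lemma memH12Zero (hU : IsOpen U) (h : TestApprox U u g φ) (hu : MemLp u 2 (lebOn U))
    (hg : MemLp g 2 (lebOn U)) : MemH12Zero U u where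
  memH12 := by
    have hw := h.hasWeakGrad hu hg
    exact ⟨hu, ⟨g, hw⟩, hg.ae_eq (hw.weakGrad_ae_eq hU).symm⟩
  approx := by
    refine ⟨φ, h.test, ?_⟩
    have hw := h.hasWeakGrad hu hg
    have hs : ∀ k, weakGrad U (fun x => φ k x - u x) =ᵐ[lebOn U]
        fun x => gradient (φ k) x - g x := fun k =>
      ((h.test k).hasWeakGrad.sub hw ((h.test k).memLp 2 _) hu
        ((h.test k).gradient_memLp 2 _) hg).weakGrad_ae_eq hU
    have hz := h.tendsto_fun.add h.tendsto_grad
    rw [add_zero] at hz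
    refine tendsto_of_tendsto_of_tendsto_of_le_of_le tendsto_const_nhds hz
      (fun _ => zero_le) (fun k => ?_)
    refine (normH12_le ?_).trans_eq (by rw [eLpNorm_congr_ae (hs k)])
    exact ((((h.test k).gradient_memLp 2 _).sub hg).1).congr (hs k).symm

end TestApprox

/-- After passing to subsequences the approximation also holds almost everywhere, as is needed to
pass to the limit in nonlinear expressions of $u$. -/
lemma MemH12Zero.exists_testApprox (hU : IsOpen U) (h : MemH12Zero U u) :
    ∃ φ, TestApprox U u (weakGrad U u) φ := by
  obtain ⟨φ, hφ, hlim⟩ := h.approx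
  have hu := h.memH12.memLp
  have hg := h.memH12.grad_memLp
  have hw : HasWeakGrad U u (weakGrad U u) := h.memH12.exists_grad.choose_spec.hasWeakGrad_weakGrad
  have hs : ∀ k, weakGrad U (fun x => φ k x - u x) =ᵐ[lebOn U]
      fun x => gradient (φ k) x - weakGrad U u x := fun k =>
    ((hφ k).hasWeakGrad.sub hw ((hφ k).memLp 2 _) hu
      ((hφ k).gradient_memLp 2 _) hg).weakGrad_ae_eq hU
  have hm : ∀ k, AEStronglyMeasurable (weakGrad U (fun x => φ k x - u x)) (lebOn U) := fun k =>
    ((((hφ k).gradient_memLp 2 _).sub hg).1).congr (hs k).symm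
  refine _root_.exists_testApprox hu hg hφ ?_ ?_
  · exact tendsto_of_tendsto_of_tendsto_of_le_of_le tendsto_const_nhds hlim
      (fun _ => zero_le) (fun k => eLpNorm_le_normH12 (hm k))
  · refine tendsto_of_tendsto_of_tendsto_of_le_of_le tendsto_const_nhds hlim
      (fun _ => zero_le) (fun k => ?_)
    show eLpNorm (fun x => gradient (φ k) x - weakGrad U u x) 2 (lebOn U) ≤ _
    rw [← eLpNorm_congr_ae (hs k)]
    exact eLpNorm_weakGrad_le_normH12 (hm k)

lemma MemH12Zero.hasWeakGrad (h : MemH12Zero U u) : HasWeakGrad U u (weakGrad U u) :=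
  h.memH12.exists_grad.choose_spec.hasWeakGrad_weakGrad

lemma MemH12Zero.weakGrad_sub_ae_eq (hU : IsOpen U) (hu : MemH12Zero U u)
    (hv : MemH12Zero U v) : weakGrad U (fun x => u x - v x) =ᵐ[lebOn U]
      fun x => weakGrad U u x - weakGrad U v x :=
  (hu.hasWeakGrad.sub hv.hasWeakGrad hu.memH12.memLp hv.memH12.memLp hu.memH12.grad_memLp
    hv.memH12.grad_memLp).weakGrad_ae_eq hU

lemma tendsto_eLpNorm_sub_sub {X E : Type*} [MeasurableSpace X] {μ : Measure X}
    [NormedAddCommGroup E] {f f' : ℕ → X → E} {g g' : X → E}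
    (hf : ∀ k, MemLp (f k) 2 μ) (hf' : ∀ k, MemLp (f' k) 2 μ) (hg : MemLp g 2 μ)
    (hg' : MemLp g' 2 μ)
    (h : Tendsto (fun k => eLpNorm (fun x => f k x - g x) 2 μ) atTop (𝓝 0))
    (h' : Tendsto (fun k => eLpNorm (fun x => f' k x - g' x) 2 μ) atTop (𝓝 0)) :
    Tendsto (fun k => eLpNorm (fun x => (f k x - f' k x) - (g x - g' x)) 2 μ) atTop (𝓝 0) := by
  have hz := h.add h'
  rw [add_zero] at hz
  refine tendsto_of_tendsto_of_tendsto_of_le_of_le tendsto_const_nhds hz (fun _ => zero_le)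
    fun k => ?_
  have he : (fun x => (f k x - f' k x) - (g x - g' x)) =
      (fun x => f k x - g x) - fun x => f' k x - g' x := by
    ext x; simp only [Pi.sub_apply]; abel
  show eLpNorm (fun x => (f k x - f' k x) - (g x - g' x)) 2 μ ≤ _
  rw [he]
  exact eLpNorm_sub_le ((hf k).sub hg).1 ((hf' k).sub hg').1 (by norm_num)

/-- The differences of the approximants approximate the difference. -/
lemma MemH12Zero.sub (hU : IsOpen U) (hu : MemH12Zero U u) (hv : MemH12Zero U v) :
    MemH12Zero U (fun x => u x - v x) := by
  obtain ⟨φ, hφ⟩ := hu.exists_testApprox hU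
  obtain ⟨ψ, hψ⟩ := hv.exists_testApprox hU
  have hT : ∀ k, IsTestFun U (φ k + (-1 : ℝ) • ψ k) := fun k =>
    (hφ.test k).add ((hψ.test k).const_smul _)
  have hgr : ∀ k x, gradient (φ k + (-1 : ℝ) • ψ k) x = gradient (φ k) x - gradient (ψ k) x := by
    intro k x
    rw [(hφ.test k).gradient_add ((hψ.test k).const_smul _), (hψ.test k).gradient_const_smul]
    simp [sub_eq_add_neg]
  have hU2 := hu.memH12.memLp.sub hv.memH12.memLp
  have hG2 := hu.memH12.grad_memLp.sub hv.memH12.grad_memLp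
  have hex : ∃ χ, TestApprox U (u - v) (weakGrad U u - weakGrad U v) χ := by
    refine _root_.exists_testApprox hU2 hG2 hT ?_ ?_
    · have := tendsto_eLpNorm_sub_sub (fun k => (hφ.test k).memLp 2 (lebOn U))
        (fun k => (hψ.test k).memLp 2 (lebOn U)) hu.memH12.memLp hv.memH12.memLp
        hφ.tendsto_fun hψ.tendsto_fun
      simpa [sub_eq_add_neg] using this
    · have := tendsto_eLpNorm_sub_sub (fun k => (hφ.test k).gradient_memLp 2 (lebOn U))
        (fun k => (hψ.test k).gradient_memLp 2 (lebOn U)) hu.memH12.grad_memLp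
        hv.memH12.grad_memLp hφ.tendsto_grad hψ.tendsto_grad
      simpa only [hgr, Pi.sub_apply] using this
  obtain ⟨χ, hχ⟩ := hex
  exact hχ.memH12Zero hU hU2 hG2

end Approximation

/-! ### The Sobolev inequality with a constant depending on the volume. -/

section Sobolev

variable {d : ℕ} {p lam : ℝ} {U : Set (Euc d)} {u : Euc d → ℝ}

lemma IsTwoLowerStar.two_le (hp : IsTwoLowerStar d p) : 2 ≤ d := by
  rcases hp with ⟨h, -⟩ | ⟨h, -⟩ <;> omega

lemma IsTwoLowerStar.one_lt (hp : IsTwoLowerStar d p) : 1 < p := by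
  rcases hp with ⟨h, rfl⟩ | ⟨-, h, -⟩
  · have : (3 : ℝ) ≤ d := by exact_mod_cast h
    rw [lt_div_iff₀ (by linarith)]; linarith
  · exact h

/-- The reciprocal of the conjugate exponent lies in `[1/2 - 1/d, 1/2)`. -/
lemma IsTwoLowerStar.inv_conj_bounds (hp : IsTwoLowerStar d p) :
    (1 / 2 : ℝ) ≤ (p / (p - 1))⁻¹ + (d : ℝ)⁻¹ ∧ (p / (p - 1))⁻¹ + (d : ℝ)⁻¹ ≤ 1 ∧
      (p / (p - 1))⁻¹ ≤ 1 / 2 := by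
  rw [inv_div]
  rcases hp with ⟨h, rfl⟩ | ⟨rfl, h, h'⟩
  · have : (3 : ℝ) ≤ d := by exact_mod_cast h
    have e : (2 * (d : ℝ) / (d + 2) - 1) / (2 * d / (d + 2)) = 1 / 2 - (d : ℝ)⁻¹ := by
      have : (d : ℝ) + 2 ≠ 0 := by positivity
      field_simp
      ring
    rw [e]
    have : (0 : ℝ) < (d : ℝ)⁻¹ := by positivity
    refine ⟨by linarith, by linarith, by linarith⟩
  · have hp0 : 0 < p := by linarith
    have h1 : (p - 1) / p ≤ 1 / 2 := by rw [div_le_div_iff₀ hp0 (by norm_num)]; linarith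
    have h2 : 0 ≤ (p - 1) / p := div_nonneg (by linarith) hp0.le
    norm_num at h1 ⊢
    refine ⟨by linarith, by linarith, by linarith⟩

lemma IsTwoLowerStar.holderConjugate (hp : IsTwoLowerStar d p) :
    ENNReal.HolderConjugate (ENNReal.ofReal p) (ENNReal.ofReal (p / (p - 1))) :=
  (Real.HolderConjugate.conjExponent hp.one_lt).ennrealOfReal

lemma IsTwoLowerStar.two_le_conj (hp : IsTwoLowerStar d p) :
    2 ≤ p / (p - 1) := by
  have h1 := hp.inv_conj_bounds.2.2
  have h2 : 0 < p / (p - 1) := div_pos (by linarith [hp.one_lt]) (by linarith [hp.one_lt])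
  rw [inv_le_comm₀ h2 (by norm_num)] at h1
  linarith

/-- Sobolev inequality for test functions, with a constant depending on the volume only. -/
lemma exists_sobolev_testFun (hp : IsTwoLowerStar d p) (V : ℝ≥0) :
    ∃ S : ℝ≥0, ∀ (U : Set (Euc d)) (φ : Euc d → ℝ), volume U = (V : ℝ≥0∞) → IsTestFun U φ →
      eLpNorm φ (ENNReal.ofReal (p / (p - 1))) (lebOn U) ≤
        S * eLpNorm (gradient φ) 2 (lebOn U) := by
  obtain ⟨hb1, hb2, -⟩ := hp.inv_conj_bounds
  -- With $q=2^*$, the exponent $r$ given by $1/r=t=1/q+1/d$ is the one whose Sobolev conjugate is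
  -- $q$. It lies in $[1,2]$, so Hölder on $U$ passes from $L^r$ to $L^2$ at the cost of
  -- $|U|^{t-1/2}$. For $d\ge3$ one has $r=2$ and no loss.
  set t : ℝ := (p / (p - 1))⁻¹ + (d : ℝ)⁻¹ with ht
  have ht0 : 0 < t := by linarith
  set r : ℝ≥0 := (t⁻¹).toNNReal with hr
  have hrt : (r : ℝ) = t⁻¹ := Real.coe_toNNReal _ (by positivity)
  have hr1 : 1 ≤ r := by
    rw [← NNReal.coe_le_coe, hrt]
    exact (one_le_inv₀ ht0).2 hb2
  have hr2 : (r : ℝ≥0∞) ≤ 2 := by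
    have : r ≤ 2 := by
      rw [← NNReal.coe_le_coe, hrt, inv_le_comm₀ ht0 (by norm_num)]
      norm_num at hb1 ⊢
      exact hb1
    exact_mod_cast this
  have hexp : (0 : ℝ) ≤ t - 1 / 2 := by linarith
  have hq0 : 0 ≤ p / (p - 1) := by linarith [hp.two_le_conj]
  refine ⟨SNormLESNormFDerivOfEqConst ℝ (volume : Measure (Euc d)) r * V ^ (t - 1 / 2),
    fun U φ hV hφ => ?_⟩
  have h1 := eLpNorm_le_eLpNorm_fderiv_of_eq (volume : Measure (Euc d))
    (hφ.smooth.of_le (by simp)) hφ.compact (p := r) (p' := (p / (p - 1)).toNNReal) hr1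
    (by simpa using lt_of_lt_of_le (by norm_num) hp.two_le)
    (by rw [Real.coe_toNNReal _ hq0, NNReal.coe_inv, hrt]; simp [ht])
  have h2 : eLpNorm (fderiv ℝ φ) r volume = eLpNorm (gradient φ) r (lebOn U) := by
    rw [eLpNorm_lebOn_eq fun x hx => hφ.gradient_eq_zero_of_notMem hx]
    exact eLpNorm_congr_norm_ae (Eventually.of_forall fun x => (norm_gradient_eq φ x).symm)
  have h3 := eLpNorm_le_eLpNorm_mul_rpow_measure_univ hr2 (hφ.gradient_memLp 2 (lebOn U)).1
  have h4 : (lebOn U Set.univ : ℝ≥0∞) ^ (1 / (r : ℝ≥0∞).toReal - 1 / (2 : ℝ≥0∞).toReal) =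
      ((V ^ (t - 1 / 2) : ℝ≥0) : ℝ≥0∞) := by
    rw [Measure.restrict_apply_univ, hV, ENNReal.coe_rpow_of_nonneg _ hexp]
    simp [hrt]
  rw [h4] at h3
  rw [eLpNorm_lebOn_eq fun x hx => hφ.eq_zero_of_notMem hx]
  refine h1.trans ?_
  rw [h2, ENNReal.coe_mul, mul_assoc]
  gcongr
  rwa [mul_comm]

/-- The inequality survives the closure: its left side is lower semicontinuous under a.e.
convergence by Fatou, its right side is continuous in the $L^2$ norm of the gradient. -/
lemma exists_sobolev (hp : IsTwoLowerStar d p) (V : ℝ≥0) :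
    ∃ S : ℝ≥0, ∀ (U : Set (Euc d)) (u : Euc d → ℝ), volume U = (V : ℝ≥0∞) → IsOpen U →
      MemH12Zero U u →
      eLpNorm u (ENNReal.ofReal (p / (p - 1))) (lebOn U) ≤
        S * eLpNorm (weakGrad U u) 2 (lebOn U) := by
  obtain ⟨S, hS⟩ := exists_sobolev_testFun hp V
  refine ⟨S, fun U u hV hU hu => ?_⟩
  obtain ⟨φ, hφ⟩ := hu.exists_testApprox hU
  refine (Lp.eLpNorm_lim_le_liminf_eLpNorm (fun k => ((hφ.test k).memLp 2 (lebOn U)).1) u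
    hφ.ae_fun).trans ?_
  have hlim : Tendsto (fun k => (S : ℝ≥0∞) *
      (eLpNorm (fun x => gradient (φ k) x - weakGrad U u x) 2 (lebOn U) +
        eLpNorm (weakGrad U u) 2 (lebOn U))) atTop
      (𝓝 (S * eLpNorm (weakGrad U u) 2 (lebOn U))) := by
    have := ENNReal.Tendsto.const_mul (a := (S : ℝ≥0∞))
      (hφ.tendsto_grad.add_const (eLpNorm (weakGrad U u) 2 (lebOn U)))
      (Or.inr ENNReal.coe_ne_top)
    simpa using this
  rw [← hlim.liminf_eq]
  refine liminf_le_liminf (Eventually.of_forall fun k => ?_)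
  refine (hS U (φ k) hV (hφ.test k)).trans ?_
  gcongr
  have hg := hu.memH12.grad_memLp.1
  have := eLpNorm_add_le (((hφ.test k).gradient_memLp 2 (lebOn U)).1.sub hg) hg
    (p := 2) (by norm_num)
  rwa [sub_add_cancel] at this

end Sobolev

/-! ### Matrix fields acting on vector fields. -/

section MatVec

variable {d : ℕ}

lemma matVec_apply (M : Matrix (Fin d) (Fin d) ℝ) (v : Euc d) (i : Fin d) :
    matVec M v i = ∑ j, M i j * v j := rfl

lemma memLp_matVec {μ : Measure (Euc d)} {A : Euc d → Matrix (Fin d) (Fin d) ℝ}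
    {g : Euc d → Euc d} (hA : ∀ i j, MemLp (fun x => A x i j) ∞ μ) (hg : MemLp g 2 μ) :
    MemLp (fun x => matVec (A x) (g x)) 2 μ := by
  refine memLp_piLp_iff.2 fun i => ?_
  simp only [matVec_apply]
  exact memLp_finsetSum _ fun j _ => (hg.eval_piLp j).mul (hA i j)

end MatVec

/-! ### The nonlinearity used for testing and its two limits. -/

/-- The regularised sign nonlinearity `t / √(1 + ε t²)`. -/
noncomputable def softId (ε t : ℝ) : ℝ := t / √(1 + ε * t ^ 2)

/-- The primitive of `softId ε` vanishing at the origin. -/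
noncomputable def softIdPrim (ε t : ℝ) : ℝ := (√(1 + ε * t ^ 2) - 1) / ε

section SoftId

variable {ε : ℝ}

lemma one_le_sqrt_one_add (hε : 0 < ε) (t : ℝ) : 1 ≤ √(1 + ε * t ^ 2) := by
  rw [Real.one_le_sqrt]
  nlinarith [mul_nonneg hε.le (sq_nonneg t)]

lemma contDiff_sqrt_one_add (hε : 0 < ε) : ContDiff ℝ ∞ fun t : ℝ => √(1 + ε * t ^ 2) :=
  ContDiff.sqrt (by fun_prop) fun t => by positivity

lemma hasDerivAt_sqrt_one_add (hε : 0 < ε) (t : ℝ) :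
    HasDerivAt (fun t : ℝ => √(1 + ε * t ^ 2)) (ε * t / √(1 + ε * t ^ 2)) t := by
  have h1 : HasDerivAt (fun t : ℝ => 1 + ε * t ^ 2) (2 * ε * t) t := by
    have := ((hasDerivAt_pow 2 t).const_mul ε).const_add 1
    rw [show 2 * ε * t = ε * ((2 : ℕ) * t ^ (2 - 1)) by norm_num; ring]
    exact this
  convert h1.sqrt (by positivity) using 1
  have := (one_le_sqrt_one_add hε t).trans_lt' one_pos
  field_simp

lemma contDiff_softId (hε : 0 < ε) : ContDiff ℝ ∞ (softId ε) :=
  contDiff_id.div (contDiff_sqrt_one_add hε) fun t =>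
    ((one_le_sqrt_one_add hε t).trans_lt' one_pos).ne'

lemma contDiff_softIdPrim (hε : 0 < ε) : ContDiff ℝ ∞ (softIdPrim ε) :=
  ((contDiff_sqrt_one_add hε).sub contDiff_const).div_const ε

lemma softId_zero : softId ε 0 = 0 := by simp [softId]

lemma softIdPrim_zero : softIdPrim ε 0 = 0 := by simp [softIdPrim]

lemma softIdPrim_nonneg (hε : 0 < ε) (t : ℝ) : 0 ≤ softIdPrim ε t :=
  div_nonneg (sub_nonneg.2 (one_le_sqrt_one_add hε t)) hε.le

lemma deriv_softIdPrim (hε : 0 < ε) (t : ℝ) : deriv (softIdPrim ε) t = softId ε t := by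
  have := ((hasDerivAt_sqrt_one_add hε t).sub_const 1).div_const ε
  refine this.deriv.trans ?_
  rw [softId]
  field_simp

lemma deriv_softId (hε : 0 < ε) (t : ℝ) :
    deriv (softId ε) t = 1 / √(1 + ε * t ^ 2) ^ 3 := by
  have h0 := (one_le_sqrt_one_add hε t).trans_lt' one_pos
  have := (hasDerivAt_id t).div (hasDerivAt_sqrt_one_add hε t) h0.ne'
  refine this.deriv.trans ?_
  have hs : √(1 + ε * t ^ 2) ^ 2 = 1 + ε * t ^ 2 := Real.sq_sqrt (by positivity)
  simp only [id]
  field_simp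
  rw [hs]; ring

lemma deriv_softId_nonneg (hε : 0 < ε) (t : ℝ) : 0 ≤ deriv (softId ε) t := by
  rw [deriv_softId hε]; positivity

lemma deriv_softId_le_one (hε : 0 < ε) (t : ℝ) : deriv (softId ε) t ≤ 1 := by
  rw [deriv_softId hε]
  exact (div_le_one (by have := one_le_sqrt_one_add hε t; positivity)).2
    (one_le_pow₀ (one_le_sqrt_one_add hε t))

/-- A bound uniform in $\varepsilon$, providing the majorant as $\varepsilon\to0$. -/
lemma abs_softId_le (hε : 0 < ε) (t : ℝ) : |softId ε t| ≤ |t| := by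
  rw [softId, abs_div, abs_of_nonneg (Real.sqrt_nonneg _)]
  exact div_le_self (abs_nonneg t) (one_le_sqrt_one_add hε t)

/-- Follows from $\sqrt{1+\varepsilon t^2}\ge\sqrt\varepsilon\,|t|$. Boundedness allows pairing with
$L^1$ functions; scaled by $\sqrt\varepsilon$ the bound is $1$, as for the sign function. -/
lemma abs_softId_le_inv (hε : 0 < ε) (t : ℝ) : |softId ε t| ≤ (√ε)⁻¹ := by
  have h0 := (one_le_sqrt_one_add hε t).trans_lt' one_pos
  rw [softId, abs_div, abs_of_nonneg (Real.sqrt_nonneg _), div_le_iff₀ h0, ← Real.sqrt_inv,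
    ← Real.sqrt_mul (by positivity), ← Real.sqrt_sq_eq_abs]
  refine Real.sqrt_le_sqrt ?_
  have : ε⁻¹ * (1 + ε * t ^ 2) = ε⁻¹ + t ^ 2 := by field_simp
  rw [this]
  have : 0 < ε⁻¹ := by positivity
  linarith

lemma mul_softId_nonneg (t : ℝ) : 0 ≤ t * softId ε t := by
  rw [softId, mul_div_assoc', ← sq]
  positivity

lemma tendsto_sqrt_one_add (t : ℝ) :
    Tendsto (fun ε : ℝ => √(1 + ε * t ^ 2)) (𝓝 0) (𝓝 1) := by
  have : Continuous fun ε : ℝ => √(1 + ε * t ^ 2) := by fun_prop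
  simpa using this.tendsto 0

lemma tendsto_softId (t : ℝ) : Tendsto (fun ε : ℝ => softId ε t) (𝓝 0) (𝓝 t) := by
  have := (tendsto_const_nhds (x := t)).div (tendsto_sqrt_one_add t) one_ne_zero
  rw [div_one] at this
  exact this

lemma tendsto_deriv_softId (t : ℝ) {e : ℕ → ℝ} (he : ∀ n, 0 < e n)
    (hlim : Tendsto e atTop (𝓝 0)) :
    Tendsto (fun n => deriv (softId (e n)) t) atTop (𝓝 1) := by
  simp only [deriv_softId (he _)]
  have := (tendsto_const_nhds (x := (1 : ℝ))).div
    (((tendsto_sqrt_one_add t).comp hlim).pow 3) (by norm_num)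
  rw [one_pow, div_one] at this
  exact this

/-- Rescaled, the nonlinearities tend to the sign function. -/
lemma tendsto_mul_softId (t : ℝ) :
    Tendsto (fun n : ℕ => ((n : ℝ) + 1) * (t * softId (((n : ℝ) + 1) ^ 2) t)) atTop (𝓝 |t|) := by
  rcases eq_or_ne t 0 with rfl | ht
  · simp
  have h1 : ∀ n : ℕ, ((n : ℝ) + 1) * (t * softId (((n : ℝ) + 1) ^ 2) t) =
      t ^ 2 / √((1 / ((n : ℝ) + 1)) ^ 2 + t ^ 2) := by
    intro n
    have hn : (0 : ℝ) < (n : ℝ) + 1 := by positivity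
    have : 1 + ((n : ℝ) + 1) ^ 2 * t ^ 2 =
        ((n : ℝ) + 1) ^ 2 * ((1 / ((n : ℝ) + 1)) ^ 2 + t ^ 2) := by field_simp
    rw [softId, this, Real.sqrt_mul (by positivity), Real.sqrt_sq hn.le]
    have : 0 < √((1 / ((n : ℝ) + 1)) ^ 2 + t ^ 2) := Real.sqrt_pos.2 (by positivity)
    field_simp
  simp only [h1]
  have h2 : Tendsto (fun n : ℕ => √((1 / ((n : ℝ) + 1)) ^ 2 + t ^ 2)) atTop (𝓝 |t|) := by
    have h3 := ((tendsto_one_div_add_atTop_nhds_zero_nat (𝕜 := ℝ)).pow 2).add_const (t ^ 2)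
    have := h3.sqrt
    simpa [Real.sqrt_sq_eq_abs] using this
  have := (tendsto_const_nhds (x := t ^ 2)).div h2 (abs_ne_zero.2 ht)
  rw [show t ^ 2 / |t| = |t| by rw [← sq_abs, sq, mul_self_div_self]] at this
  exact this

end SoftId

/-! ### Testing the equation with nonlinear functions of the solution. -/

section Testing

variable {d : ℕ} {lam p α : ℝ} {U : Set (Euc d)} {A : Euc d → Matrix (Fin d) (Fin d) ℝ}
  {B F : Euc d → Euc d} {c f u : Euc d → ℝ}

lemma Admissible.isFiniteMeasure (hA : Admissible lam p U A B c) : IsFiniteMeasure (lebOn U) :=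
  ⟨by rw [Measure.restrict_apply_univ]; exact hA.bounded.measure_lt_top⟩

/-- The convection term is nonnegative when tested with a monotone nonlinearity of `u`. -/
lemma Admissible.integral_drift_nonneg (hA : Admissible lam p U A B c) (hu : MemH12Zero U u)
    {η : ℝ → ℝ} (hη : ContDiff ℝ ∞ η) (h0 : η 0 = 0) (hpos : ∀ t, 0 ≤ η t) {K : ℝ}
    (hK : ∀ t, |deriv η t| ≤ K) :
    0 ≤ ∫ x in U, deriv η (u x) * inner ℝ (B x) (weakGrad U u x) := by
  obtain ⟨φ, hφ⟩ := hu.exists_testApprox hA.isOpen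
  have hc : Continuous (deriv η) := hη.continuous_deriv (by simp)
  have hlim := tendsto_integral_mul_inner (bk := fun k x => deriv η (φ k x))
    (b := fun x => deriv η (u x)) (K := K) hA.B_memLp hu.memH12.grad_memLp
    (fun k => (hφ.test k).gradient_memLp 2 _) hφ.tendsto_grad
    (fun k => (hc.comp (hφ.test k).smooth.continuous).aestronglyMeasurable)
    (fun k x => hK _) (by
      filter_upwards [hφ.ae_fun] with x hx using (hc.tendsto _).comp hx)
  refine ge_of_tendsto' hlim fun k => ?_
  -- By the chain rule the approximating integral is $\int\langle B,\nabla\eta(\varphi_k)\rangle$,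
  -- where $\eta(\varphi_k)\ge0$ is a test function.
  have := hA.B_div _ ((hφ.test k).comp hη h0) fun x => hpos _
  simpa only [(hφ.test k).gradient_comp hη, inner_smul_right] using this

/-- The weak formulation may be tested with bounded smooth functions of `u`. -/
lemma IsWeakSol.test_comp (hA : Admissible lam p U A B c) (hsol : IsWeakSol U A B c α f F u)
    (hcu : Integrable (fun x => c x * u x) (lebOn U)) (hf : MemLp f 1 (lebOn U))
    (hF : MemLp F 2 (lebOn U)) {ψ : ℝ → ℝ} (hψ : ContDiff ℝ ∞ ψ) (h0 : ψ 0 = 0) {K K' : ℝ}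
    (hK : ∀ t, |ψ t| ≤ K) (hK' : ∀ t, |deriv ψ t| ≤ K') :
    (∫ x in U, deriv ψ (u x) *
        inner ℝ (matVec (A x) (weakGrad U u x)) (weakGrad U u x)) +
      ∫ x in U, (inner ℝ (B x) (weakGrad U u x) + (c x + α) * u x) * ψ (u x) =
    (∫ x in U, f x * ψ (u x)) + ∫ x in U, deriv ψ (u x) * inner ℝ (F x) (weakGrad U u x) := by
  have := hA.isFiniteMeasure
  have hu := hsol.memH12Zero
  obtain ⟨φ, hφ⟩ := hu.exists_testApprox hA.isOpen
  have hg := hu.memH12.grad_memLp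
  have hAg := memLp_matVec hA.A_memLp hg
  have hc : Continuous (deriv ψ) := hψ.continuous_deriv (by simp)
  have hm : ∀ k, AEStronglyMeasurable (fun x => ψ (φ k x)) (lebOn U) := fun k =>
    (hψ.continuous.comp (hφ.test k).smooth.continuous).aestronglyMeasurable
  have hm' : ∀ k, AEStronglyMeasurable (fun x => deriv ψ (φ k x)) (lebOn U) := fun k =>
    (hc.comp (hφ.test k).smooth.continuous).aestronglyMeasurable
  have hl : ∀ᵐ x ∂(lebOn U), Tendsto (fun k => ψ (φ k x)) atTop (𝓝 (ψ (u x))) := by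
    filter_upwards [hφ.ae_fun] with x hx using (hψ.continuous.tendsto _).comp hx
  have hl' : ∀ᵐ x ∂(lebOn U), Tendsto (fun k => deriv ψ (φ k x)) atTop (𝓝 (deriv ψ (u x))) := by
    filter_upwards [hφ.ae_fun] with x hx using (hc.tendsto _).comp hx
  -- The lower order terms are only integrable, which is why $\psi$ has to be bounded.
  have hlow : Integrable (fun x => inner ℝ (B x) (weakGrad U u x) + (c x + α) * u x)
      (lebOn U) := by
    refine (integrable_inner_of_memLp hA.B_memLp hg).add ?_
    simp only [add_mul]
    exact hcu.add ((hu.memH12.memLp.integrable (by norm_num)).const_mul α)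
  have hf1 : Integrable f (lebOn U) := memLp_one_iff_integrable.1 hf
  have hgk : ∀ k, MemLp (gradient (φ k)) 2 (lebOn U) := fun k => (hφ.test k).gradient_memLp 2 _
  -- The terms with $\nabla\varphi_k$ use strong $L^2$ convergence of the gradients, the others
  -- bounded a.e. convergence.
  have t1 := tendsto_integral_mul_inner hAg hg hgk hφ.tendsto_grad hm' (fun k x => hK' _) hl'
  have t2 := tendsto_integral_mul_bdd hlow hm (fun k x => hK _) hl
  have t3 := tendsto_integral_mul_bdd hf1 hm (fun k x => hK _) hl
  have t4 := tendsto_integral_mul_inner hF hg hgk hφ.tendsto_grad hm' (fun k x => hK' _) hl'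
  refine tendsto_nhds_unique (t1.add t2) ((t3.add t4).congr fun k => ?_)
  have he := hsol.eqn _ ((hφ.test k).comp hψ h0)
  simp only [lhsIntegrand, rhsIntegrand, (hφ.test k).gradient_comp hψ, inner_smul_right] at he
  rw [integral_add, integral_add] at he
  · exact he.symm
  · exact hf1.mul_bdd (hm k) (Eventually.of_forall fun x => hK _)
  · exact (integrable_inner_of_memLp hF (hgk k)).bdd_mul (hm' k)
      (Eventually.of_forall fun x => hK' _)
  · exact (integrable_inner_of_memLp hAg (hgk k)).bdd_mul (hm' k)
      (Eventually.of_forall fun x => hK' _)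
  · exact hlow.mul_bdd (hm k) (Eventually.of_forall fun x => hK _)

/-- The basic inequality obtained by testing with `softId ε u`. -/
lemma IsWeakSol.softId_inequality (hA : Admissible lam p U A B c)
    (hsol : IsWeakSol U A B c α f F u) (hcu : Integrable (fun x => c x * u x) (lebOn U))
    (hf : MemLp f 1 (lebOn U)) (hF : MemLp F 2 (lebOn U)) {ε : ℝ} (hε : 0 < ε) :
    lam * (∫ x in U, deriv (softId ε) (u x) * ‖weakGrad U u x‖ ^ 2) +
      α * (∫ x in U, u x * softId ε (u x)) ≤
    (∫ x in U, f x * softId ε (u x)) +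
      ∫ x in U, deriv (softId ε) (u x) * inner ℝ (F x) (weakGrad U u x) := by
  have := hA.isFiniteMeasure
  have hu := hsol.memH12Zero
  have hg := hu.memH12.grad_memLp
  have hAg := memLp_matVec hA.A_memLp hg
  have hd : ∀ t, |deriv (softId ε) t| ≤ 1 := fun t => by
    rw [abs_of_nonneg (deriv_softId_nonneg hε t)]; exact deriv_softId_le_one hε t
  have hm : AEStronglyMeasurable (fun x => softId ε (u x)) (lebOn U) :=
    (contDiff_softId hε).continuous.comp_aestronglyMeasurable hu.memH12.memLp.1
  have hm' : AEStronglyMeasurable (fun x => deriv (softId ε) (u x)) (lebOn U) :=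
    ((contDiff_softId hε).continuous_deriv (by simp)).comp_aestronglyMeasurable hu.memH12.memLp.1
  have heq := hsol.test_comp hA hcu hf hF (contDiff_softId hε) softId_zero
    (abs_softId_le_inv hε) hd
  -- Taking the primitive as nonlinearity turns its derivative into `softId ε`, so this is exactly
  -- the drift term of the tested equation.
  have hdrift := hA.integral_drift_nonneg hu (contDiff_softIdPrim hε) softIdPrim_zero
    (softIdPrim_nonneg hε) (K := (√ε)⁻¹)
    (fun t => by rw [deriv_softIdPrim hε]; exact abs_softId_le_inv hε t)
  simp only [deriv_softIdPrim hε] at hdrift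
  have hbd : ∀ {h : Euc d → ℝ}, Integrable h (lebOn U) →
      Integrable (fun x => h x * softId ε (u x)) (lebOn U) := fun hh =>
    hh.mul_bdd hm (Eventually.of_forall fun x => abs_softId_le_inv hε _)
  have hu1 : Integrable u (lebOn U) := hu.memH12.memLp.integrable (by norm_num)
  have hell : lam * (∫ x in U, deriv (softId ε) (u x) * ‖weakGrad U u x‖ ^ 2) ≤
      ∫ x in U, deriv (softId ε) (u x) *
        inner ℝ (matVec (A x) (weakGrad U u x)) (weakGrad U u x) := by
    rw [← integral_const_mul]
    refine integral_mono_ae ?_ ?_ ?_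
    · exact (hg.norm.integrable_sq.bdd_mul hm' (Eventually.of_forall fun x => hd _)).const_mul lam
    · exact (integrable_inner_of_memLp hAg hg).bdd_mul hm' (Eventually.of_forall fun x => hd _)
    · filter_upwards [hA.A_elliptic] with x hx
      have := mul_le_mul_of_nonneg_left (hx (weakGrad U u x)) (deriv_softId_nonneg hε (u x))
      linarith
  have hlow : α * (∫ x in U, u x * softId ε (u x)) ≤
      ∫ x in U, (inner ℝ (B x) (weakGrad U u x) + (c x + α) * u x) * softId ε (u x) := by
    have e : ∀ x, (inner ℝ (B x) (weakGrad U u x) + (c x + α) * u x) * softId ε (u x) =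
        softId ε (u x) * inner ℝ (B x) (weakGrad U u x) +
          (c x * u x * softId ε (u x) + α * (u x * softId ε (u x))) := fun x => by ring
    simp only [e]
    rw [integral_add, integral_add, integral_const_mul]
    · have hc0 : 0 ≤ ∫ x in U, c x * u x * softId ε (u x) := by
        refine integral_nonneg_of_ae ?_
        filter_upwards [hA.c_nonneg] with x hx
        rw [Pi.zero_apply, mul_assoc]
        exact mul_nonneg hx (mul_softId_nonneg _)
      linarith
    · exact hbd hcu
    · exact (hbd hu1).const_mul α
    · exact (integrable_inner_of_memLp hA.B_memLp hg).bdd_mul hm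
        (Eventually.of_forall fun x => abs_softId_le_inv hε _)
    · exact (hbd hcu).add ((hbd hu1).const_mul α)
  linarith

/-- `L¹` contraction for integrable right-hand sides. -/
lemma IsWeakSol.eLpNorm_one_le (hlam : 0 < lam) (hα : 0 < α) (hA : Admissible lam p U A B c)
    (hsol : IsWeakSol U A B c α f 0 u) (hcu : Integrable (fun x => c x * u x) (lebOn U))
    (hf : MemLp f 1 (lebOn U)) :
    eLpNorm u 1 (lebOn U) ≤ ENNReal.ofReal α⁻¹ * eLpNorm f 1 (lebOn U) := by
  have := hA.isFiniteMeasure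
  have hu := hsol.memH12Zero
  have hu1 : Integrable u (lebOn U) := hu.memH12.memLp.integrable (by norm_num)
  have hf1 : Integrable f (lebOn U) := memLp_one_iff_integrable.1 hf
  -- With $\varepsilon=(n+1)^2$ the factor $n+1$ equals $\sqrt\varepsilon$, so the scaled
  -- nonlinearity is bounded by $1$.
  have hsc : ∀ (n : ℕ) (t : ℝ), ((n : ℝ) + 1) * |softId (((n : ℝ) + 1) ^ 2) t| ≤ 1 := by
    intro n t
    have hn : (0 : ℝ) < (n : ℝ) + 1 := by positivity
    have := mul_le_mul_of_nonneg_left (abs_softId_le_inv (pow_pos hn 2) t) hn.le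
    rwa [Real.sqrt_sq hn.le, mul_inv_cancel₀ hn.ne'] at this
  have hm : ∀ n : ℕ, AEStronglyMeasurable (fun x => softId (((n : ℝ) + 1) ^ 2) (u x)) (lebOn U) :=
    fun n => (contDiff_softId (by positivity)).continuous.comp_aestronglyMeasurable
      hu.memH12.memLp.1
  have hle : ∀ n : ℕ, α * (∫ x in U, ((n : ℝ) + 1) * (u x * softId (((n : ℝ) + 1) ^ 2) (u x))) ≤
      ∫ x in U, |f x| := by
    intro n
    have hn : (0 : ℝ) < (n : ℝ) + 1 := by positivity
    have hε : (0 : ℝ) < ((n : ℝ) + 1) ^ 2 := by positivity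
    have h1 := hsol.softId_inequality hA hcu hf MemLp.zero hε
    -- The diffusion term has a sign because the nonlinearity is increasing, and is dropped.
    have h2 : 0 ≤ ∫ x in U, deriv (softId (((n : ℝ) + 1) ^ 2)) (u x) * ‖weakGrad U u x‖ ^ 2 :=
      integral_nonneg fun x => mul_nonneg (deriv_softId_nonneg hε _) (by positivity)
    simp only [Pi.zero_apply, inner_zero_left, mul_zero, integral_zero, add_zero] at h1
    have h3 : ((n : ℝ) + 1) * ∫ x in U, f x * softId (((n : ℝ) + 1) ^ 2) (u x) ≤
        ∫ x in U, |f x| := by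
      rw [← integral_const_mul]
      refine integral_mono ((hf1.mul_bdd (hm n) (Eventually.of_forall fun x =>
        abs_softId_le_inv hε _)).const_mul _) hf1.abs fun x => ?_
      calc ((n : ℝ) + 1) * (f x * softId (((n : ℝ) + 1) ^ 2) (u x))
          ≤ ((n : ℝ) + 1) * |f x * softId (((n : ℝ) + 1) ^ 2) (u x)| :=
            mul_le_mul_of_nonneg_left (le_abs_self _) hn.le
        _ = |f x| * (((n : ℝ) + 1) * |softId (((n : ℝ) + 1) ^ 2) (u x)|) := by
            rw [abs_mul]; ring
        _ ≤ |f x| := mul_le_of_le_one_right (abs_nonneg _) (hsc n _)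
    rw [integral_const_mul]
    have h4 : α * (∫ x in U, u x * softId (((n : ℝ) + 1) ^ 2) (u x)) ≤
        ∫ x in U, f x * softId (((n : ℝ) + 1) ^ 2) (u x) := by
      have := mul_nonneg hlam.le h2
      linarith
    have h5 := mul_le_mul_of_nonneg_left h4 hn.le
    linarith
  have hlim : Tendsto (fun n : ℕ => ∫ x in U, ((n : ℝ) + 1) *
      (u x * softId (((n : ℝ) + 1) ^ 2) (u x))) atTop (𝓝 (∫ x in U, |u x|)) := by
    refine tendsto_integral_of_dominated_convergence (fun x => |u x|)
      (fun n => (hu1.1.mul (hm n)).const_mul _) hu1.abs (fun n => ?_)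
      (Eventually.of_forall fun x => tendsto_mul_softId (u x))
    filter_upwards with x
    have hn : (0 : ℝ) < (n : ℝ) + 1 := by positivity
    rw [norm_mul, norm_mul, Real.norm_eq_abs, Real.norm_eq_abs, Real.norm_eq_abs,
      abs_of_pos hn, mul_left_comm]
    exact mul_le_of_le_one_right (abs_nonneg _) (hsc n _)
  have hfin : α * (∫ x in U, |u x|) ≤ ∫ x in U, |f x| :=
    le_of_tendsto' (hlim.const_mul α) hle
  have hfin' : (∫ x in U, |u x|) ≤ α⁻¹ * ∫ x in U, |f x| := by
    rw [le_inv_mul_iff₀ hα]; exact hfin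
  have key : ∀ {h : Euc d → ℝ}, Integrable h (lebOn U) →
      eLpNorm h 1 (lebOn U) = ENNReal.ofReal (∫ x in U, |h x|) := by
    intro h hh
    rw [eLpNorm_one_eq_lintegral_enorm, ← ofReal_integral_norm_eq_lintegral_enorm hh]
    rfl
  rw [key hu1, key hf1, ← ENNReal.ofReal_mul (by positivity)]
  exact ENNReal.ofReal_le_ofReal hfin'

/-- The energy inequality obtained by testing with `u` itself. -/
lemma IsWeakSol.energy_inequality (hα : 0 ≤ α) (hA : Admissible lam p U A B c)
    (hsol : IsWeakSol U A B c α f F u) (hcu : Integrable (fun x => c x * u x) (lebOn U))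
    (hf : MemLp f 1 (lebOn U)) (hfu : Integrable (fun x => f x * u x) (lebOn U))
    (hF : MemLp F 2 (lebOn U)) :
    lam * (∫ x in U, ‖weakGrad U u x‖ ^ 2) ≤
      (∫ x in U, f x * u x) + ∫ x in U, inner ℝ (F x) (weakGrad U u x) := by
  have hu := hsol.memH12Zero
  have hg := hu.memH12.grad_memLp
  -- Here $\varepsilon\to0$: the nonlinearity tends to the identity and its derivative, bounded by
  -- $1$, tends to $1$.
  let e : ℕ → ℝ := fun n => 1 / ((n : ℝ) + 1)
  have he : ∀ n, 0 < e n := fun n => by positivity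
  have helim : Tendsto e atTop (𝓝 0) := tendsto_one_div_add_atTop_nhds_zero_nat
  have hd : ∀ n t, |deriv (softId (e n)) t| ≤ 1 := fun n t => by
    rw [abs_of_nonneg (deriv_softId_nonneg (he n) t)]; exact deriv_softId_le_one (he n) t
  have hm : ∀ n, AEStronglyMeasurable (fun x => softId (e n) (u x)) (lebOn U) := fun n =>
    (contDiff_softId (he n)).continuous.comp_aestronglyMeasurable hu.memH12.memLp.1
  have hm' : ∀ n, AEStronglyMeasurable (fun x => deriv (softId (e n)) (u x)) (lebOn U) := fun n =>
    ((contDiff_softId (he n)).continuous_deriv (by simp)).comp_aestronglyMeasurable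
      hu.memH12.memLp.1
  have hl : ∀ {h : Euc d → ℝ}, Integrable h (lebOn U) →
      Tendsto (fun n => ∫ x in U, deriv (softId (e n)) (u x) * h x) atTop
        (𝓝 (∫ x in U, h x)) := by
    intro h hh
    have := tendsto_integral_mul_bdd (bk := fun n x => deriv (softId (e n)) (u x))
      (b := fun _ => 1) hh hm' (fun n x => hd n _)
      (Eventually.of_forall fun x => tendsto_deriv_softId _ he helim)
    simpa only [mul_comm (h _), one_mul] using this
  have t1 := hl hg.norm.integrable_sq
  have t2 := hl (integrable_inner_of_memLp hF hg)
  -- Since $|\psi_\varepsilon(u)|\le|u|$, the integrable function $|fu|$ is a majorant.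
  have t3 : Tendsto (fun n => ∫ x in U, f x * softId (e n) (u x)) atTop
      (𝓝 (∫ x in U, f x * u x)) := by
    refine tendsto_integral_of_dominated_convergence (fun x => ‖f x * u x‖)
      (fun n => hf.1.mul (hm n)) hfu.norm (fun n => ?_)
      (Eventually.of_forall fun x => ((tendsto_softId (u x)).comp helim).const_mul _)
    filter_upwards with x
    rw [norm_mul, norm_mul]
    exact mul_le_mul_of_nonneg_left (abs_softId_le (he n) _) (norm_nonneg _)
  refine le_of_tendsto_of_tendsto' (t1.const_mul lam) (t3.add t2) fun n => ?_
  have h1 := hsol.softId_inequality hA hcu hf hF (he n)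
  have h2 : 0 ≤ α * ∫ x in U, u x * softId (e n) (u x) :=
    mul_nonneg hα (integral_nonneg fun x => mul_softId_nonneg _)
  linarith

end Testing

/-! ### An abstract projection lemma. -/

section Lions

variable {Φ H : Type*} [AddCommGroup Φ] [Module ℝ Φ] [NormedAddCommGroup H]
  [InnerProductSpace ℝ H] [CompleteSpace H]

/-- Lions' projection lemma: a form `⟪j φ, T ψ⟫` that is coercive on `Φ` can be solved in the
closure of the range of `j`. -/
lemma exists_inner_eq_of_coercive (j T : Φ →ₗ[ℝ] H) (l : Φ →ₗ[ℝ] ℝ) {m C : ℝ} (hm : 0 < m)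
    (hC : 0 ≤ C) (hco : ∀ φ, m * ‖j φ‖ ^ 2 ≤ inner ℝ (j φ) (T φ))
    (hl : ∀ φ, |l φ| ≤ C * ‖j φ‖) :
    ∃ z ∈ (LinearMap.range j).topologicalClosure, ∀ φ, inner ℝ z (T φ) = l φ := by
  set K := (LinearMap.range j).topologicalClosure with hK
  have : CompleteSpace K := (Submodule.isClosed_topologicalClosure _).completeSpace_coe
  have hjK : ∀ φ, j φ ∈ K := fun φ =>
    Submodule.le_topologicalClosure _ (LinearMap.mem_range_self j φ)
  -- Only pairings of `T φ` with elements of `K` matter, so `T φ` may be projected onto `K`.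
  let L : Φ →ₗ[ℝ] K := (K.orthogonalProjectionOnto : H →ₗ[ℝ] K) ∘ₗ T
  have hinner : ∀ (z : K) φ, inner ℝ z (L φ) = inner ℝ (z : H) (T φ) := fun z φ =>
    Submodule.inner_orthogonalProjectionOnto_eq_of_mem_left z (T φ)
  -- Coercivity with Cauchy–Schwarz bounds `j φ` by `L φ`. Hence `l` is bounded in terms of `L φ`
  -- and factors through the range of `L`.
  have hbd : ∀ φ, ‖j φ‖ ≤ m⁻¹ * ‖L φ‖ := by
    intro φ
    have h1 : m * ‖j φ‖ ^ 2 ≤ ‖j φ‖ * ‖L φ‖ := by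
      refine (hco φ).trans ?_
      rw [← hinner ⟨j φ, hjK φ⟩ φ]
      exact real_inner_le_norm _ _
    rw [le_inv_mul_iff₀ hm]
    rcases (norm_nonneg (j φ)).eq_or_lt with h0 | h0
    · rw [← h0, mul_zero]; exact norm_nonneg _
    · exact le_of_mul_le_mul_left (by linarith) h0
  have hlL : ∀ φ, |l φ| ≤ C * m⁻¹ * ‖L φ‖ := fun φ =>
    (hl φ).trans (by rw [mul_assoc]; exact mul_le_mul_of_nonneg_left (hbd φ) hC)
  have hker : LinearMap.ker L ≤ LinearMap.ker l := by
    intro φ hφ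
    have := hlL φ
    rw [LinearMap.mem_ker.1 hφ, norm_zero, mul_zero] at this
    exact LinearMap.mem_ker.2 (abs_nonpos_iff.1 this)
  let g₀ : LinearMap.range L →ₗ[ℝ] ℝ :=
    (LinearMap.ker L).liftQ l hker ∘ₗ (L.quotKerEquivRange.symm : LinearMap.range L →ₗ[ℝ] _)
  have hg₀ : ∀ φ, g₀ ⟨L φ, LinearMap.mem_range_self L φ⟩ = l φ := fun φ => by
    simp [g₀]
  let g : StrongDual ℝ (LinearMap.range L) := g₀.mkContinuous (C * m⁻¹) (by
    rintro ⟨_, φ, rfl⟩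
    rw [hg₀]
    exact hlL φ)
  -- Hahn–Banach extends the functional to `K`, and Riesz represents it by the desired element.
  obtain ⟨G, hG, -⟩ := exists_extension_norm_eq (LinearMap.range L) g
  refine ⟨((InnerProductSpace.toDual ℝ K).symm G : K), Subtype.property _, fun φ => ?_⟩
  rw [← hinner, InnerProductSpace.toDual_symm_apply, ← hg₀ φ]
  exact hG ⟨L φ, LinearMap.mem_range_self L φ⟩

end Lions

/-! ### Existence for data in divergence form. -/

/-- The vector space of test functions on `U`. -/
def testFunSubmodule {d : ℕ} (U : Set (Euc d)) : Submodule ℝ (Euc d → ℝ) where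
  carrier := {φ | IsTestFun U φ}
  add_mem' h h' := h.add h'
  zero_mem' := IsTestFun.zero
  smul_mem' a _ h := h.const_smul a

section Existence

variable {d : ℕ} {lam p α : ℝ} {U : Set (Euc d)} {A : Euc d → Matrix (Fin d) (Fin d) ℝ}
  {B F : Euc d → Euc d} {c : Euc d → ℝ}

lemma inner_matVec_transpose (M : Matrix (Fin d) (Fin d) ℝ) (v w : Euc d) :
    inner ℝ v (matVec M.transpose w) = inner ℝ (matVec M v) w := by
  simp only [matVec, EuclideanSpace.inner_eq_star_dotProduct, star_trivial]
  rw [Matrix.mulVec_transpose, ← Matrix.dotProduct_mulVec]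

lemma matVec_add (M : Matrix (Fin d) (Fin d) ℝ) (v w : Euc d) :
    matVec M (v + w) = matVec M v + matVec M w := by
  simp [matVec, Matrix.mulVec_add]

lemma matVec_smul (M : Matrix (Fin d) (Fin d) ℝ) (a : ℝ) (v : Euc d) :
    matVec M (a • v) = a • matVec M v := by
  simp [matVec, Matrix.mulVec_smul]

lemma real_inner_mul (a b : ℝ) : inner ℝ a b = a * b := by
  simp [mul_comm]

/-- The pair `(w φ, ∇φ)`. -/
noncomputable def weightedPair (w φ : Euc d → ℝ) (x : Euc d) : WithLp 2 (ℝ × Euc d) :=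
  WithLp.toLp 2 (w x * φ x, gradient φ x)

/-- The representative of the functional `z ↦ a(z, φ)` for the bilinear form `a` of the equation,
with respect to the weighted pairs. -/
noncomputable def adjointPair (A : Euc d → Matrix (Fin d) (Fin d) ℝ) (B : Euc d → Euc d)
    (w φ : Euc d → ℝ) (x : Euc d) : WithLp 2 (ℝ × Euc d) :=
  WithLp.toLp 2 (w x * φ x, matVec (A x).transpose (gradient φ x) + φ x • B x)

lemma memLp_weightedPair {w φ : Euc d → ℝ} (hw : MemLp w 2 (lebOn U)) (hφ : IsTestFun U φ) :
    MemLp (weightedPair w φ) 2 (lebOn U) :=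
  memLp_prodLp_iff.2 ⟨(hφ.memLp ∞ (lebOn U)).mul hw, hφ.gradient_memLp 2 _⟩

lemma memLp_adjointPair {w φ : Euc d → ℝ} (hw : MemLp w 2 (lebOn U))
    (hA : ∀ i j, MemLp (fun x => A x i j) ∞ (lebOn U)) (hB : MemLp B 2 (lebOn U))
    (hφ : IsTestFun U φ) : MemLp (adjointPair A B w φ) 2 (lebOn U) :=
  memLp_prodLp_iff.2 ⟨(hφ.memLp ∞ (lebOn U)).mul hw,
    (memLp_matVec (fun i j => hA j i) (hφ.gradient_memLp 2 _)).add
      (hB.smul (hφ.memLp ∞ (lebOn U)))⟩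

/-- A pointwise linear assignment of square integrable functions, as a map into `L²`. -/
noncomputable def toL2Linear {X Φ E : Type*} [MeasurableSpace X] {μ : Measure X}
    [AddCommGroup Φ] [Module ℝ Φ] [NormedAddCommGroup E] [NormedSpace ℝ E] (f : Φ → X → E)
    (hf : ∀ φ, MemLp (f φ) 2 μ) (hadd : ∀ φ ψ x, f (φ + ψ) x = f φ x + f ψ x)
    (hsmul : ∀ (a : ℝ) φ x, f (a • φ) x = a • f φ x) : Φ →ₗ[ℝ] Lp E 2 μ where
  toFun φ := (hf φ).toLp (f φ)
  map_add' φ ψ := by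
    rw [← MemLp.toLp_add]
    exact MemLp.toLp_congr _ _ (Eventually.of_forall fun x => hadd φ ψ x)
  map_smul' a φ := by
    rw [RingHom.id_apply, ← MemLp.toLp_const_smul]
    exact MemLp.toLp_congr _ _ (Eventually.of_forall fun x => hsmul a φ x)

lemma inner_toLp_toLp {X H : Type*} [MeasurableSpace X] {μ : Measure X} [NormedAddCommGroup H]
    [InnerProductSpace ℝ H] {f g : X → H} (hf : MemLp f 2 μ) (hg : MemLp g 2 μ) :
    inner ℝ (hf.toLp f) (hg.toLp g) = ∫ x, inner ℝ (f x) (g x) ∂μ := by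
  rw [L2.inner_def]
  refine integral_congr_ae ?_
  filter_upwards [hf.coeFn_toLp, hg.coeFn_toLp] with x hx hy
  rw [hx, hy]

/-- The test function $\varphi^2\ge0$ in the condition on $\operatorname{div}B$ gives twice this
integral. -/
lemma Admissible.integral_drift_self_nonneg (hA : Admissible lam p U A B c) {φ : Euc d → ℝ}
    (hφ : IsTestFun U φ) : 0 ≤ ∫ x in U, φ x * inner ℝ (B x) (gradient φ x) := by
  have hη : ContDiff ℝ ∞ fun t : ℝ => t ^ 2 := by fun_prop
  have h := hA.B_div _ (hφ.comp hη (by simp)) fun x => sq_nonneg _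
  have e : ∀ x, inner ℝ (B x) (gradient (fun x => φ x ^ 2) x) =
      2 * (φ x * inner ℝ (B x) (gradient φ x)) := by
    intro x
    have := hφ.gradient_comp hη x
    rw [this, inner_smul_right]
    simp
    ring
  simp only [e] at h
  rw [integral_const_mul] at h
  linarith

/-- Existence of weak solutions with right-hand side in divergence form. -/
lemma Admissible.exists_isWeakSol (hlam : 0 < lam) (hα : 0 < α) (hp : 1 ≤ p)
    (hA : Admissible lam p U A B c)
    (hF : MemLp F 2 (lebOn U)) : ∃ z, IsWeakSol U A B c α 0 F z := by
  have hfin := hA.isFiniteMeasure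
  -- The weight $\sqrt{c+\alpha}$ builds the zeroth order term into the Hilbert norm. It is in $L^2$
  -- since $c\in L^1$, and it is at least $\sqrt\alpha>0$, so it can be divided out again.
  let w : Euc d → ℝ := fun x => √(c x + α)
  have hc1 : Integrable c (lebOn U) :=
    hA.c_memLp.integrable (by rw [← ENNReal.ofReal_one]; exact ENNReal.ofReal_le_ofReal hp)
  have hwsq : ∀ᵐ x ∂(lebOn U), w x ^ 2 = c x + α ∧ √α ≤ w x := by
    filter_upwards [hA.c_nonneg] with x hx
    exact ⟨Real.sq_sqrt (by linarith), Real.sqrt_le_sqrt (by linarith)⟩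
  have hwm : AEStronglyMeasurable w (lebOn U) :=
    Real.continuous_sqrt.comp_aestronglyMeasurable (hc1.1.add aestronglyMeasurable_const)
  have hw : MemLp w 2 (lebOn U) := (memLp_two_iff_integrable_sq hwm).2
    ((hc1.add (integrable_const α)).congr (by
      filter_upwards [hwsq] with x hx using hx.1.symm))
  have hj := fun φ : testFunSubmodule U => memLp_weightedPair hw φ.2
  have hT := fun φ : testFunSubmodule U => memLp_adjointPair hw hA.A_memLp hA.B_memLp φ.2
  let j : testFunSubmodule U →ₗ[ℝ] Lp (WithLp 2 (ℝ × Euc d)) 2 (lebOn U) :=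
    toL2Linear (fun φ => weightedPair w φ) hj
      (fun φ ψ x => by
        simp only [weightedPair, Submodule.coe_add, IsTestFun.gradient_add φ.2 ψ.2, Pi.add_apply,
          mul_add]
        rfl)
      (fun a φ x => by
        simp only [weightedPair, Submodule.coe_smul, IsTestFun.gradient_const_smul φ.2,
          Pi.smul_apply, smul_eq_mul, mul_left_comm]
        rfl)
  let T : testFunSubmodule U →ₗ[ℝ] Lp (WithLp 2 (ℝ × Euc d)) 2 (lebOn U) :=
    toL2Linear (fun φ => adjointPair A B w φ) hT
      (fun φ ψ x => by
        simp only [adjointPair, Submodule.coe_add, IsTestFun.gradient_add φ.2 ψ.2, Pi.add_apply,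
          mul_add, matVec_add, add_smul]
        rw [add_add_add_comm]
        rfl)
      (fun a φ x => by
        simp only [adjointPair, Submodule.coe_smul, IsTestFun.gradient_const_smul φ.2,
          Pi.smul_apply, smul_eq_mul, mul_left_comm, matVec_smul, mul_smul, ← smul_add]
        rfl)
  have hFp : MemLp (fun x => (WithLp.toLp 2 (0, F x) : WithLp 2 (ℝ × Euc d))) 2 (lebOn U) :=
    memLp_prodLp_iff.2 ⟨MemLp.zero, hF⟩
  let l : testFunSubmodule U →ₗ[ℝ] ℝ := (innerₛₗ ℝ (hFp.toLp _)) ∘ₗ j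
  have hlval : ∀ φ : testFunSubmodule U, l φ = ∫ x in U, inner ℝ (F x) (gradient (φ : Euc d → ℝ) x) := by
    intro φ
    refine (inner_toLp_toLp hFp (hj φ)).trans ?_
    simp [weightedPair, WithLp.prod_inner_apply]
  -- The weighted part of the form enters with coefficient $1$, the gradient part with `lam` by
  -- ellipticity, and the drift is nonnegative.
  have hco : ∀ φ, min 1 lam * ‖j φ‖ ^ 2 ≤ inner ℝ (j φ) (T φ) := by
    intro φ
    have hφ : IsTestFun U φ := φ.2
    have hgr := hφ.gradient_memLp 2 (lebOn U)
    have hAg := memLp_matVec hA.A_memLp hgr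
    have hB : Integrable (fun x => (φ : Euc d → ℝ) x * inner ℝ (B x) (gradient (φ : Euc d → ℝ) x)) (lebOn U) := by
      obtain ⟨C, hC⟩ := hφ.exists_bound
      exact (integrable_inner_of_memLp hA.B_memLp hgr).bdd_mul (hφ.memLp 2 (lebOn U)).1
        (Eventually.of_forall hC)
    have hwφ : Integrable (fun x => (w x * (φ : Euc d → ℝ) x) ^ 2) (lebOn U) :=
      ((hj φ).prodLp_fst).integrable_sq
    have e1 : ‖j φ‖ ^ 2 = ∫ x in U, ((w x * (φ : Euc d → ℝ) x) ^ 2 + ‖gradient (φ : Euc d → ℝ) x‖ ^ 2) := by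
      rw [← real_inner_self_eq_norm_sq]
      refine (inner_toLp_toLp (hj φ) (hj φ)).trans ?_
      congr 1 with x
      rw [WithLp.prod_inner_apply, real_inner_self_eq_norm_sq, real_inner_self_eq_norm_sq,
        Real.norm_eq_abs, sq_abs]
      rfl
    have e2 : inner ℝ (j φ) (T φ) = (∫ x in U, ((w x * (φ : Euc d → ℝ) x) ^ 2 +
        inner ℝ (matVec (A x) (gradient (φ : Euc d → ℝ) x)) (gradient (φ : Euc d → ℝ) x))) +
        ∫ x in U, (φ : Euc d → ℝ) x * inner ℝ (B x) (gradient (φ : Euc d → ℝ) x) := by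
      refine (inner_toLp_toLp (hj φ) (hT φ)).trans
        (Eq.trans ?_ (integral_add (hwφ.add (integrable_inner_of_memLp hAg hgr)) hB))
      congr 1 with x
      simp only [weightedPair, adjointPair, WithLp.prod_inner_apply, inner_add_right,
        inner_matVec_transpose, inner_smul_right, real_inner_comm (gradient _ x) (B x)]
      simp only [real_inner_mul]
      ring
    rw [e1, e2, ← integral_const_mul]
    refine le_add_of_le_of_nonneg ?_ (hA.integral_drift_self_nonneg hφ)
    refine integral_mono_ae ((hwφ.add hgr.norm.integrable_sq).const_mul _)
      (hwφ.add (integrable_inner_of_memLp hAg hgr)) ?_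
    filter_upwards [hA.A_elliptic] with x hx
    have h1 := hx (gradient (φ : Euc d → ℝ) x)
    have h2 : min 1 lam * (w x * (φ : Euc d → ℝ) x) ^ 2 ≤ (w x * (φ : Euc d → ℝ) x) ^ 2 :=
      mul_le_of_le_one_left (sq_nonneg _) (min_le_left _ _)
    have h3 : min 1 lam * ‖gradient (φ : Euc d → ℝ) x‖ ^ 2 ≤
        lam * ‖gradient (φ : Euc d → ℝ) x‖ ^ 2 :=
      mul_le_mul_of_nonneg_right (min_le_right _ _) (sq_nonneg _)
    rw [mul_add]
    linarith
  obtain ⟨z, hz, hsol⟩ := exists_inner_eq_of_coercive j T l (lt_min one_pos hlam)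
    (norm_nonneg (hFp.toLp _)) hco (fun φ => abs_real_inner_le_norm (hFp.toLp _) (j φ))
  have hzL := Lp.memLp z
  have hg : MemLp (fun x => (z x).snd) 2 (lebOn U) := hzL.prodLp_snd
  have hαs : 0 < √α := Real.sqrt_pos.2 hα
  -- The abstract solution is a limit of pairs $(w\varphi_k,\nabla\varphi_k)$. Dividing its first
  -- component by $w\ge\sqrt\alpha$ keeps $L^2$ convergence, so $\varphi_k\to u$ and the second
  -- component is $\nabla u$.
  let u : Euc d → ℝ := fun x => (z x).fst / w x
  have hum : AEStronglyMeasurable u (lebOn U) :=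
    (hzL.prodLp_fst.1.aemeasurable.div hwm.aemeasurable).aestronglyMeasurable
  have hu : MemLp u 2 (lebOn U) := by
    refine hzL.prodLp_fst.of_le_mul (c := (√α)⁻¹) hum ?_
    filter_upwards [hwsq] with x hx
    rw [norm_div, div_eq_inv_mul]
    gcongr
    exact hx.2.trans (le_abs_self _)
  obtain ⟨y, hy, hylim⟩ := mem_closure_iff_seq_limit.1 hz
  choose φ hφ using hy
  have hlim : Tendsto (fun k => eLpNorm (fun x => weightedPair w (φ k) x - z x) 2 (lebOn U))
      atTop (𝓝 0) := by
    refine ((Lp.tendsto_Lp_iff_tendsto_eLpNorm' _ _).1 hylim).congr fun k => ?_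
    refine eLpNorm_congr_ae ?_
    rw [← hφ k]
    filter_upwards [(hj (φ k)).coeFn_toLp] with x hx
    rw [Pi.sub_apply, ← hx]
    rfl
  have hex : ∃ φ', TestApprox U u (fun x => (z x).snd) φ' := by
    refine exists_testApprox (φ := fun k => φ k) hu hg (fun k => (φ k).2) ?_ ?_
    · have hlim' := ENNReal.Tendsto.const_mul (a := ENNReal.ofReal (√α)⁻¹) hlim
        (Or.inr ENNReal.ofReal_ne_top)
      rw [mul_zero] at hlim'
      refine tendsto_of_tendsto_of_tendsto_of_le_of_le tendsto_const_nhds hlim'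
        (fun _ => zero_le) fun k => ?_
      refine eLpNorm_le_mul_eLpNorm_of_ae_le_mul ?_ 2
      filter_upwards [hwsq] with x hx
      have hw0 : 0 < w x := hαs.trans_le hx.2
      have h1 : ‖(weightedPair w (φ k) x - z x).fst‖ ≤ ‖weightedPair w (φ k) x - z x‖ :=
        WithLp.norm_fst_le ℝ _
      have h2 : (φ k : Euc d → ℝ) x - u x =
          (w x)⁻¹ * (weightedPair w (φ k) x - z x).fst := by
        simp only [weightedPair, u, WithLp.sub_fst]
        field_simp
        rfl
      rw [h2, norm_mul, norm_inv, Real.norm_of_nonneg hw0.le]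
      gcongr
      exact hx.2
    · refine tendsto_of_tendsto_of_tendsto_of_le_of_le tendsto_const_nhds hlim
        (fun _ => zero_le) fun k => eLpNorm_mono fun x => ?_
      exact WithLp.norm_snd_le ℝ (weightedPair w (φ k) x - z x)
  obtain ⟨φ', hφ'⟩ := hex
  have hmem : MemH12Zero U u := hφ'.memH12Zero hA.isOpen hu hg
  have hwg := (hφ'.hasWeakGrad hu hg).weakGrad_ae_eq hA.isOpen
  have hlhs : ∀ ψ, IsTestFun U ψ → lhsIntegrand U A B c α u ψ =ᵐ[(lebOn U)]
      fun x => inner ℝ (z x) (adjointPair A B w ψ x) := by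
    intro ψ hψ
    filter_upwards [hwg, hwsq] with x hx hwx
    have hw0 : 0 < w x := hαs.trans_le hwx.2
    have h1 : (c x + α) * u x = w x * (z x).fst := by
      rw [← hwx.1]
      simp only [u]
      field_simp
    rw [lhsIntegrand, hx, h1]
    simp only [adjointPair, WithLp.prod_inner_apply, inner_add_right,
        inner_matVec_transpose, inner_smul_right, real_inner_comm (B x)]
    simp only [WithLp.ofLp_fst, WithLp.ofLp_snd, real_inner_mul]
    ring
  refine ⟨u, hmem, fun ψ hψ => ?_, fun ψ hψ => ?_, fun ψ hψ => ?_⟩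
  · exact (integrable_inner_of_memLp hzL (memLp_adjointPair hw hA.A_memLp hA.B_memLp hψ)).congr
      (hlhs ψ hψ).symm
  · have : rhsIntegrand 0 F ψ = fun x => inner ℝ (F x) (gradient ψ x) := by
      ext x; simp [rhsIntegrand]
    rw [this]
    exact integrable_inner_of_memLp hF (hψ.gradient_memLp 2 _)
  · have h1 := hsol ⟨ψ, hψ⟩
    rw [hlval, L2.inner_def] at h1
    rw [integral_congr_ae (hlhs ψ hψ)]
    simp only [rhsIntegrand, Pi.zero_apply, zero_mul, zero_add]
    rw [← h1]
    refine integral_congr_ae ?_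
    filter_upwards [(hT ⟨ψ, hψ⟩).coeFn_toLp] with x hx
    show _ = inner ℝ (z x) (((hT ⟨ψ, hψ⟩).toLp _ : Lp _ 2 (lebOn U)) x)
    rw [hx]

end Existence

/-! ### The energy estimate and the choice of its constant. -/

section EnergyEstimate

variable {d : ℕ} {lam p α : ℝ} {U : Set (Euc d)} {A : Euc d → Matrix (Fin d) (Fin d) ℝ}
  {B F : Euc d → Euc d} {c f u : Euc d → ℝ} {q : ℝ≥0∞}

lemma eLpNorm_mul_le_of_holder {X : Type*} [MeasurableSpace X] {μ : Measure X} {r q : ℝ≥0∞}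
    [ENNReal.HolderConjugate r q] {f g : X → ℝ} (hf : AEStronglyMeasurable f μ)
    (hg : AEStronglyMeasurable g μ) :
    eLpNorm (fun x => f x * g x) 1 μ ≤ eLpNorm f r μ * eLpNorm g q μ := by
  have := eLpNorm_le_eLpNorm_mul_eLpNorm'_of_norm (p := r) (q := q) (r := 1) hf hg
    (fun a b => a * b) 1 (Eventually.of_forall fun x => by simp)
  simpa using this

lemma integrable_mul_of_holder {X : Type*} [MeasurableSpace X] {μ : Measure X} {r q : ℝ≥0∞}
    [ENNReal.HolderConjugate r q] {f g : X → ℝ} (hf : MemLp f r μ) (hg : MemLp g q μ) :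
    Integrable (fun x => f x * g x) μ :=
  memLp_one_iff_integrable.1 ⟨hf.1.mul hg.1,
    (eLpNorm_mul_le_of_holder hf.1 hg.1).trans_lt (ENNReal.mul_lt_top hf.2 hg.2)⟩

/-- The gradient bound from the energy inequality and a Sobolev bound for the solution. -/
lemma IsWeakSol.eLpNorm_weakGrad_le [ENNReal.HolderConjugate (ENNReal.ofReal p) q] {S : ℝ≥0}
    (hp : 1 ≤ p) (hlam : 0 < lam) (hα : 0 ≤ α) (hA : Admissible lam p U A B c)
    (hf : MemLp f (ENNReal.ofReal p) (lebOn U)) (hF : MemLp F 2 (lebOn U))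
    (hsol : IsWeakSol U A B c α f F u)
    (hS : eLpNorm u q (lebOn U) ≤ S * eLpNorm (weakGrad U u) 2 (lebOn U)) :
    eLpNorm (weakGrad U u) 2 (lebOn U) ≤ ENNReal.ofReal lam⁻¹ *
      (S * eLpNorm f (ENNReal.ofReal p) (lebOn U) + eLpNorm F 2 (lebOn U)) := by
  have := hA.isFiniteMeasure
  have hu := hsol.memH12Zero.memH12
  have hg := hu.grad_memLp
  set X := eLpNorm (weakGrad U u) 2 (lebOn U) with hX
  have huq : MemLp u q (lebOn U) :=
    ⟨hu.memLp.1, hS.trans_lt (ENNReal.mul_lt_top ENNReal.coe_lt_top hg.2)⟩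
  have hp' : (1 : ℝ≥0∞) ≤ ENNReal.ofReal p := by
    rw [← ENNReal.ofReal_one]; exact ENNReal.ofReal_le_ofReal hp
  have hen := hsol.energy_inequality hα hA (integrable_mul_of_holder hA.c_memLp huq)
    (hf.mono_exponent hp') (integrable_mul_of_holder hf huq) hF
  have hsq : ENNReal.ofReal (∫ x in U, ‖weakGrad U u x‖ ^ 2) = X ^ 2 := by
    rw [ofReal_integral_eq_lintegral_ofReal hg.norm.integrable_sq
      (Eventually.of_forall fun x => by positivity), hX, eLpNorm_two_sq]
    congr 1 with x
    rw [ENNReal.ofReal_pow (norm_nonneg _), ofReal_norm]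
  have h1 : ENNReal.ofReal lam * X ^ 2 ≤
      (S * eLpNorm f (ENNReal.ofReal p) (lebOn U) + eLpNorm F 2 (lebOn U)) * X := by
    rw [← hsq, ← ENNReal.ofReal_mul hlam.le]
    refine (ENNReal.ofReal_le_ofReal hen).trans (ENNReal.ofReal_add_le.trans ?_)
    rw [add_mul]
    have hb : ∀ t : ℝ, ENNReal.ofReal t ≤ ‖t‖ₑ := fun t => by
      rw [← ofReal_norm]; exact ENNReal.ofReal_le_ofReal (le_abs_self t)
    refine add_le_add ?_ ?_
    · refine (hb _).trans ((norm_integral_le_eLpNorm_one _).trans ?_)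
      refine (eLpNorm_mul_le_of_holder (r := ENNReal.ofReal p) (q := q) hf.1 hu.memLp.1).trans ?_
      calc eLpNorm f (ENNReal.ofReal p) (lebOn U) * eLpNorm u q (lebOn U)
          ≤ eLpNorm f (ENNReal.ofReal p) (lebOn U) * (S * X) := by gcongr
        _ = _ := by ring
    · exact (hb _).trans ((norm_integral_le_eLpNorm_one _).trans (eLpNorm_inner_le hF.1 hg.1))
  rw [sq, ← mul_assoc] at h1
  rcases eq_or_ne X 0 with h0 | h0
  · rw [h0]; exact zero_le
  have h2 := (ENNReal.mul_le_mul_iff_left h0 hg.2.ne).1 h1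
  rw [ENNReal.ofReal_inv_of_pos hlam]
  rwa [← ENNReal.mul_le_iff_le_inv (by simpa using hlam) ENNReal.ofReal_ne_top]

/-- The constant of the energy estimate may be chosen such that it also controls the norm of the
solution in the Sobolev exponent. -/
lemma exists_energyConst {N : ℝ} {V : ℝ≥0} (hp : IsTwoLowerStar d p) (hlam : 0 < lam)
    (hN : 0 ≤ N) (hNV : V ≠ 0 → 0 < N) :
    ∃ C₁ : ℝ, 0 < C₁ ∧ IsEnergyConst d p lam V C₁ ∧
      ∀ (U : Set (Euc d)) (A : Euc d → Matrix (Fin d) (Fin d) ℝ) (B : Euc d → Euc d)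
        (c : Euc d → ℝ) (α : ℝ) (f : Euc d → ℝ) (F : Euc d → Euc d) (u : Euc d → ℝ),
        V ≠ 0 → volume U = (V : ℝ≥0∞) → Admissible lam p U A B c → 0 ≤ α →
        MemLp f (ENNReal.ofReal p) (lebOn U) → MemLp F 2 (lebOn U) →
        IsWeakSol U A B c α f F u →
        eLpNorm u (ENNReal.ofReal (p / (p - 1))) (lebOn U) ≤ ENNReal.ofReal N *
          (ENNReal.ofReal C₁ *
            (eLpNorm f (ENNReal.ofReal p) (lebOn U) + eLpNorm F 2 (lebOn U))) := by
  obtain ⟨S, hS⟩ := exists_sobolev hp V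
  have := hp.holderConjugate
  set q := p / (p - 1) with hq
  have hq2 : 2 ≤ q := hp.two_le_conj
  have he : 0 ≤ 1 / 2 - 1 / q := by
    have : 1 / q ≤ 1 / 2 := one_div_le_one_div_of_le (by norm_num) hq2
    linarith
  -- The Poincaré constant: Sobolev's inequality followed by Hölder from $L^q$ to $L^2$.
  set P : ℝ≥0 := S * V ^ (1 / 2 - 1 / q) with hP
  -- The factor $S+1$ dominates the coefficients $S$ of $\|f\|$ and $1$ of $\|F\|$ in the gradient
  -- bound.
  obtain ⟨K, hK⟩ : ∃ K : ℝ, K = lam⁻¹ * (S + 1) := ⟨_, rfl⟩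
  have hK0 : 0 < K := by rw [hK]; positivity
  have hgrad : ∀ {U : Set (Euc d)} {A B c α f F u}, volume U = (V : ℝ≥0∞) →
      Admissible lam p U A B c → 0 ≤ α →
      MemLp f (ENNReal.ofReal p) (lebOn U) → MemLp F 2 (lebOn U) →
      IsWeakSol U A B c α f F u → eLpNorm (weakGrad U u) 2 (lebOn U) ≤ ENNReal.ofReal K *
        (eLpNorm f (ENNReal.ofReal p) (lebOn U) + eLpNorm F 2 (lebOn U)) := by
    intro U A B c α f F u hV hA hα hf hF hsol
    refine (hsol.eLpNorm_weakGrad_le hp.one_lt.le hlam hα hA hf hF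
      (hS U u hV hA.isOpen hsol.memH12Zero)).trans ?_
    rw [hK, ENNReal.ofReal_mul (by positivity), ENNReal.ofReal_add (by positivity) (by norm_num),
      ENNReal.ofReal_coe_nnreal, ENNReal.ofReal_one, mul_assoc]
    gcongr
    rw [add_mul, mul_add, one_mul]
    calc _ ≤ (S : ℝ≥0∞) * eLpNorm f (ENNReal.ofReal p) (lebOn U) +
          (S * eLpNorm F 2 (lebOn U) + eLpNorm f (ENNReal.ofReal p) (lebOn U)) +
          eLpNorm F 2 (lebOn U) := by
            gcongr; exact le_self_add
      _ = _ := by ring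
  -- The part $1+P$ serves the full norm. The part $S/N$ ensures $NC_1\ge SK$, the bound for the
  -- $L^q$ norm; if $N=0$ the quotient is $0$, harmless since then $V=0$.
  refine ⟨K * (1 + P + S / N), by positivity, ?_, ?_⟩
  · intro U A B c α f F u hV hA hα hf hF hsol
    have hg := hgrad hV hA hα hf hF hsol
    have hu := hsol.memH12Zero.memH12
    have h2 : eLpNorm u 2 (lebOn U) ≤ P * eLpNorm (weakGrad U u) 2 (lebOn U) := by
      refine (eLpNorm_le_eLpNorm_mul_rpow_measure_univ (q := ENNReal.ofReal q) ?_
        hu.memLp.1).trans ?_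
      · rw [← ENNReal.ofReal_ofNat]; exact ENNReal.ofReal_le_ofReal hq2
      · rw [Measure.restrict_apply_univ, hV, ENNReal.toReal_ofReal (by linarith),
          ENNReal.toReal_ofNat, ENNReal.coe_mul, ENNReal.coe_rpow_of_nonneg _ he, mul_right_comm]
        gcongr
        exact hS U u hV hA.isOpen hsol.memH12Zero
    calc normH12 U u ≤ eLpNorm u 2 (lebOn U) + eLpNorm (weakGrad U u) 2 (lebOn U) :=
          normH12_le hu.grad_memLp.1
      _ ≤ P * eLpNorm (weakGrad U u) 2 (lebOn U) + eLpNorm (weakGrad U u) 2 (lebOn U) := by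
          gcongr
      _ = ENNReal.ofReal (1 + P) * eLpNorm (weakGrad U u) 2 (lebOn U) := by
          rw [ENNReal.ofReal_add (by norm_num) (by positivity), ENNReal.ofReal_one,
            ENNReal.ofReal_coe_nnreal]
          ring
      _ ≤ ENNReal.ofReal (1 + P) * (ENNReal.ofReal K *
          (eLpNorm f (ENNReal.ofReal p) (lebOn U) + eLpNorm F 2 (lebOn U))) := by gcongr
      _ = ENNReal.ofReal (K * (1 + P)) *
          (eLpNorm f (ENNReal.ofReal p) (lebOn U) + eLpNorm F 2 (lebOn U)) := by
          rw [ENNReal.ofReal_mul hK0.le]; ring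
      _ ≤ _ := by
          refine mul_le_mul' (ENNReal.ofReal_le_ofReal ?_) le_rfl
          exact mul_le_mul_of_nonneg_left (le_add_of_nonneg_right (by positivity)) hK0.le
  · intro U A B c α f F u hV0 hV hA hα hf hF hsol
    have hg := hgrad hV hA hα hf hF hsol
    have hN0 := hNV hV0
    calc eLpNorm u (ENNReal.ofReal q) (lebOn U)
        ≤ S * eLpNorm (weakGrad U u) 2 (lebOn U) := hS U u hV hA.isOpen hsol.memH12Zero
      _ ≤ S * (ENNReal.ofReal K *
          (eLpNorm f (ENNReal.ofReal p) (lebOn U) + eLpNorm F 2 (lebOn U))) := by gcongr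
      _ = ENNReal.ofReal (S * K) *
          (eLpNorm f (ENNReal.ofReal p) (lebOn U) + eLpNorm F 2 (lebOn U)) := by
          rw [ENNReal.ofReal_mul (by positivity), ENNReal.ofReal_coe_nnreal, mul_assoc]
      _ ≤ ENNReal.ofReal (N * (K * (1 + P + S / N))) *
          (eLpNorm f (ENNReal.ofReal p) (lebOn U) + eLpNorm F 2 (lebOn U)) := by
          refine mul_le_mul' (ENNReal.ofReal_le_ofReal ?_) le_rfl
          have e : N * (K * (1 + P + S / N)) = S * K + N * (K * (1 + P)) := by
            field_simp
            ring
          rw [e]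
          exact le_add_of_nonneg_right (by positivity)
      _ = _ := by rw [ENNReal.ofReal_mul hN, mul_assoc]

end EnergyEstimate

/-! ### Differences of solutions and change of coefficients. -/

section Linearity

variable {d : ℕ} {lam p α : ℝ} {U : Set (Euc d)} {A A' : Euc d → Matrix (Fin d) (Fin d) ℝ}
  {B B' F F' : Euc d → Euc d} {c c' f f' u v : Euc d → ℝ}

lemma matVec_sub (M : Matrix (Fin d) (Fin d) ℝ) (v w : Euc d) :
    matVec M (v - w) = matVec M v - matVec M w := by
  simp [matVec, Matrix.mulVec_sub]

lemma sub_matVec (M M' : Matrix (Fin d) (Fin d) ℝ) (v : Euc d) :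
    matVec (M - M') v = matVec M v - matVec M' v := by
  simp [matVec, Matrix.sub_mulVec]

lemma integrable_rhsIntegrand {φ : Euc d → ℝ} (hf : MemLp f 1 (lebOn U))
    (hF : MemLp F 2 (lebOn U)) (hφ : IsTestFun U φ) :
    Integrable (rhsIntegrand f F φ) (lebOn U) := by
  obtain ⟨C, hC⟩ := hφ.exists_bound
  exact ((memLp_one_iff_integrable.1 hf).mul_bdd (hφ.memLp 2 (lebOn U)).1
    (Eventually.of_forall hC)).add (integrable_inner_of_memLp hF (hφ.gradient_memLp 2 _))

/-- The difference of two weak solutions of equations with the same coefficients. -/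
lemma IsWeakSol.sub (hU : IsOpen U) (hu : IsWeakSol U A B c α f F u)
    (hv : IsWeakSol U A B c α f' F' v) :
    IsWeakSol U A B c α (fun x => f x - f' x) (fun x => F x - F' x) (fun x => u x - v x) := by
  have hl : ∀ φ, IsTestFun U φ → lhsIntegrand U A B c α (fun x => u x - v x) φ =ᵐ[lebOn U]
      fun x => lhsIntegrand U A B c α u φ x - lhsIntegrand U A B c α v φ x := by
    intro φ hφ
    filter_upwards [hu.memH12Zero.weakGrad_sub_ae_eq hU hv.memH12Zero] with x hx
    simp only [lhsIntegrand, hx, matVec_sub, inner_sub_left, inner_sub_right]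
    ring
  have hr : ∀ φ x, rhsIntegrand (fun x => f x - f' x) (fun x => F x - F' x) φ x =
      rhsIntegrand f F φ x - rhsIntegrand f' F' φ x := by
    intro φ x
    simp only [rhsIntegrand, inner_sub_left]
    ring
  refine ⟨hu.memH12Zero.sub hU hv.memH12Zero, fun φ hφ => ?_, fun φ hφ => ?_, fun φ hφ => ?_⟩
  · exact ((hu.integrable_lhs φ hφ).sub (hv.integrable_lhs φ hφ)).congr (hl φ hφ).symm
  · exact ((hu.integrable_rhs φ hφ).sub (hv.integrable_rhs φ hφ)).congr
      (Eventually.of_forall fun x => (hr φ x).symm)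
  · rw [integral_congr_ae (hl φ hφ)]
    simp only [hr]
    rw [integral_sub (hu.integrable_lhs φ hφ) (hv.integrable_lhs φ hφ),
      integral_sub (hu.integrable_rhs φ hφ) (hv.integrable_rhs φ hφ), hu.eqn φ hφ, hv.eqn φ hφ]

/-- A weak solution solves the equation with other coefficients and a modified right-hand side. -/
lemma IsWeakSol.change_coeffs (hu : IsWeakSol U A B c α f F u)
    (hh : MemLp (fun x => inner ℝ (B' x - B x) (weakGrad U u x) + (c' x - c x) * u x) 1 (lebOn U))
    (hG : MemLp (fun x => matVec (A' x - A x) (weakGrad U u x)) 2 (lebOn U)) :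
    IsWeakSol U A' B' c' α
      (fun x => f x + (inner ℝ (B' x - B x) (weakGrad U u x) + (c' x - c x) * u x))
      (fun x => F x + matVec (A' x - A x) (weakGrad U u x)) u := by
  have hl : ∀ φ x, lhsIntegrand U A' B' c' α u φ x = lhsIntegrand U A B c α u φ x +
      rhsIntegrand (fun x => inner ℝ (B' x - B x) (weakGrad U u x) + (c' x - c x) * u x)
        (fun x => matVec (A' x - A x) (weakGrad U u x)) φ x := by
    intro φ x
    simp only [lhsIntegrand, rhsIntegrand, sub_matVec, inner_sub_left]
    ring
  have hr : ∀ φ x, rhsIntegrand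
      (fun x => f x + (inner ℝ (B' x - B x) (weakGrad U u x) + (c' x - c x) * u x))
      (fun x => F x + matVec (A' x - A x) (weakGrad U u x)) φ x = rhsIntegrand f F φ x +
      rhsIntegrand (fun x => inner ℝ (B' x - B x) (weakGrad U u x) + (c' x - c x) * u x)
        (fun x => matVec (A' x - A x) (weakGrad U u x)) φ x := by
    intro φ x
    simp only [rhsIntegrand, inner_add_left]
    ring
  refine ⟨hu.memH12Zero, fun φ hφ => ?_, fun φ hφ => ?_, fun φ hφ => ?_⟩
  · exact ((hu.integrable_lhs φ hφ).add (integrable_rhsIntegrand hh hG hφ)).congr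
      (Eventually.of_forall fun x => (hl φ x).symm)
  · exact ((hu.integrable_rhs φ hφ).add (integrable_rhsIntegrand hh hG hφ)).congr
      (Eventually.of_forall fun x => (hr φ x).symm)
  · simp only [hl, hr]
    rw [integral_add (hu.integrable_lhs φ hφ) (integrable_rhsIntegrand hh hG hφ),
      integral_add (hu.integrable_rhs φ hφ) (integrable_rhsIntegrand hh hG hφ), hu.eqn φ hφ]

end Linearity

/-! ### Quantitative stability in $L^1$. -/

section Stability

variable {d : ℕ} {lam p α : ℝ} {U : Set (Euc d)} {A A' : Euc d → Matrix (Fin d) (Fin d) ℝ}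
  {B B' F F' : Euc d → Euc d} {c c' f f' u u' : Euc d → ℝ} {q : ℝ≥0∞}

/-- The `L¹` estimate for a solution with right-hand side `f - div F`. -/
lemma IsWeakSol.eLpNorm_one_le_add {C : ℝ} {V : ℝ≥0} (hp : IsTwoLowerStar d p) (hlam : 0 < lam)
    (hα : 0 < α) (hC : IsEnergyConst d p lam V C) (hV : volume U = (V : ℝ≥0∞))
    (hA : Admissible lam p U A B c) (hf : MemLp f 1 (lebOn U)) (hF : MemLp F 2 (lebOn U))
    (hsol : IsWeakSol U A B c α f F u) :
    eLpNorm u 1 (lebOn U) ≤ ENNReal.ofReal α⁻¹ * eLpNorm f 1 (lebOn U) +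
      ENNReal.ofReal ((V : ℝ) ^ (1 / 2 : ℝ) * C) * eLpNorm F 2 (lebOn U) := by
  obtain ⟨S, hS⟩ := exists_sobolev hp V
  have := hp.holderConjugate
  -- Subtracting `z` leaves the data $(f,0)$, to which the $L^1$ contraction applies. The function
  -- `z` is left to the energy estimate.
  obtain ⟨z, hz⟩ := hA.exists_isWeakSol hlam hα hp.one_lt.le hF
  have hw0 := hsol.sub hA.isOpen hz
  have hw : IsWeakSol U A B c α f 0 (fun x => u x - z x) := by
    simp only [Pi.zero_apply, sub_zero, sub_self] at hw0
    exact hw0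
  -- Sobolev and Hölder make $c(u-z)$ integrable, as the contraction requires.
  have hwq : MemLp (fun x => u x - z x) (ENNReal.ofReal (p / (p - 1))) (lebOn U) :=
    ⟨hw.memH12Zero.memH12.memLp.1, (hS U _ hV hA.isOpen hw.memH12Zero).trans_lt
      (ENNReal.mul_lt_top ENNReal.coe_lt_top hw.memH12Zero.memH12.grad_memLp.2)⟩
  have h1 := hw.eLpNorm_one_le hlam hα hA (integrable_mul_of_holder hA.c_memLp hwq) hf
  have hzH := hz.memH12Zero.memH12
  have h2 : eLpNorm z 1 (lebOn U) ≤
      ENNReal.ofReal ((V : ℝ) ^ (1 / 2 : ℝ) * C) * eLpNorm F 2 (lebOn U) := by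
    have h3 := hC U A B c α 0 F z hV hA hα.le MemLp.zero hF hz
    rw [eLpNorm_zero, zero_add] at h3
    have h4 := (eLpNorm_le_normH12 hzH.grad_memLp.1).trans h3
    refine (eLpNorm_le_eLpNorm_mul_rpow_measure_univ (q := 2) (by norm_num) hzH.memLp.1).trans ?_
    rw [Measure.restrict_apply_univ, hV, ENNReal.ofReal_mul (by positivity), mul_comm, mul_assoc,
      ← ENNReal.ofReal_rpow_of_nonneg V.coe_nonneg (by norm_num)]
    refine mul_le_mul' (le_of_eq ?_) h4
    rw [show (1 / (1 : ℝ≥0∞).toReal - 1 / (2 : ℝ≥0∞).toReal) = (1 / 2 : ℝ) by norm_num]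
    congr 1
    exact (ENNReal.ofReal_coe_nnreal).symm
  have h5 : u = (fun x => u x - z x) + z := by
    ext x; simp
  calc eLpNorm u 1 (lebOn U) = eLpNorm ((fun x => u x - z x) + z) 1 (lebOn U) := by rw [← h5]
    _ ≤ eLpNorm (fun x => u x - z x) 1 (lebOn U) + eLpNorm z 1 (lebOn U) :=
        eLpNorm_add_le hw.memH12Zero.memH12.memLp.1 hzH.memLp.1 le_rfl
    _ ≤ _ := add_le_add h1 h2

/-- Stability of weak solutions in `L¹`, in terms of the norms of the limit solution. -/
lemma IsWeakSol.eLpNorm_sub_le {C : ℝ} {V : ℝ≥0} (hp : IsTwoLowerStar d p) (hlam : 0 < lam)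
    (hα : 0 < α) (hC : IsEnergyConst d p lam V C) (hV : volume U = (V : ℝ≥0∞))
    (hA : Admissible lam p U A B c) (hf : MemLp f 1 (lebOn U)) (hF : MemLp F 2 (lebOn U))
    (hsol : IsWeakSol U A B c α f F u)
    (hA' : Admissible lam p U A' B' c') (hf' : MemLp f' 1 (lebOn U)) (hF' : MemLp F' 2 (lebOn U))
    (hsol' : IsWeakSol U A' B' c' α f' F' u')
    (huq : MemLp u (ENNReal.ofReal (p / (p - 1))) (lebOn U)) :
    eLpNorm (fun x => u' x - u x) 1 (lebOn U) ≤
      ENNReal.ofReal α⁻¹ * (eLpNorm (fun x => B x - B' x) 2 (lebOn U) *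
          eLpNorm (weakGrad U u) 2 (lebOn U) +
        eLpNorm (fun x => c x - c' x) (ENNReal.ofReal p) (lebOn U) *
          eLpNorm u (ENNReal.ofReal (p / (p - 1))) (lebOn U)) +
      ENNReal.ofReal ((V : ℝ) ^ (1 / 2 : ℝ) * C) *
        eLpNorm (fun x => matVec (A' x - A x) (weakGrad U u x)) 2 (lebOn U) +
      ENNReal.ofReal α⁻¹ * eLpNorm (fun x => f x - f' x) 1 (lebOn U) +
      ENNReal.ofReal ((V : ℝ) ^ (1 / 2 : ℝ) * C) * eLpNorm (fun x => F x - F' x) 2 (lebOn U) := by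
  have := hp.holderConjugate
  have hg := hsol.memH12Zero.memH12.grad_memLp
  have hB := hA.B_memLp.sub hA'.B_memLp
  have hc := hA.c_memLp.sub hA'.c_memLp
  have hB1 : MemLp (fun x => inner ℝ (B x - B' x) (weakGrad U u x)) 1 (lebOn U) :=
    memLp_one_iff_integrable.2 (integrable_inner_of_memLp hB hg)
  have hc1 : MemLp (fun x => (c x - c' x) * u x) 1 (lebOn U) :=
    memLp_one_iff_integrable.2 (integrable_mul_of_holder hc huq)
  have hG : MemLp (fun x => matVec (A' x - A x) (weakGrad U u x)) 2 (lebOn U) :=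
    memLp_matVec (fun i j => (hA'.A_memLp i j).sub (hA.A_memLp i j)) hg
  -- The limit solution is made to solve the primed equation by moving the coefficient differences
  -- to the right, so that the two solutions can be subtracted.
  have hch := hsol.change_coeffs (A' := A') (B' := B') (c' := c')
    ((hB1.add hc1).neg.ae_eq (Eventually.of_forall fun x => by
      simp only [Pi.neg_apply, Pi.add_apply, inner_sub_left]; ring)) hG
  have hdiff := hsol'.sub hA.isOpen hch
  have h1 : MemLp (fun x => (inner ℝ (B x - B' x) (weakGrad U u x) + (c x - c' x) * u x) -
      (f x - f' x)) 1 (lebOn U) := (hB1.add hc1).sub (hf.sub hf')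
  have h2 : MemLp (fun x => -(matVec (A' x - A x) (weakGrad U u x) + (F x - F' x))) 2 (lebOn U) :=
    (hG.add (hF.sub hF')).neg
  have e1 : (fun x => f' x - (f x + (inner ℝ (B' x - B x) (weakGrad U u x) +
      (c' x - c x) * u x))) = fun x => (inner ℝ (B x - B' x) (weakGrad U u x) +
      (c x - c' x) * u x) - (f x - f' x) := by
    ext x
    simp only [inner_sub_left]
    ring
  have e2 : (fun x => F' x - (F x + matVec (A' x - A x) (weakGrad U u x))) =
      fun x => -(matVec (A' x - A x) (weakGrad U u x) + (F x - F' x)) := by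
    ext1 x
    abel
  rw [e1, e2] at hdiff
  refine (hdiff.eLpNorm_one_le_add hp hlam hα hC hV hA' h1 h2).trans ?_
  have n1 : eLpNorm (fun x => (inner ℝ (B x - B' x) (weakGrad U u x) + (c x - c' x) * u x) -
      (f x - f' x)) 1 (lebOn U) ≤ (eLpNorm (fun x => B x - B' x) 2 (lebOn U) *
          eLpNorm (weakGrad U u) 2 (lebOn U) +
        eLpNorm (fun x => c x - c' x) (ENNReal.ofReal p) (lebOn U) *
          eLpNorm u (ENNReal.ofReal (p / (p - 1))) (lebOn U)) +
      eLpNorm (fun x => f x - f' x) 1 (lebOn U) := by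
    refine (MeasureTheory.eLpNorm_sub_le (hB1.add hc1).1 (hf.sub hf').1 le_rfl).trans ?_
    refine add_le_add ((eLpNorm_add_le hB1.1 hc1.1 le_rfl).trans ?_) le_rfl
    exact add_le_add (eLpNorm_inner_le hB.1 hg.1) (eLpNorm_mul_le_of_holder hc.1 huq.1)
  have n2 : eLpNorm (fun x => -(matVec (A' x - A x) (weakGrad U u x) + (F x - F' x))) 2
      (lebOn U) ≤ eLpNorm (fun x => matVec (A' x - A x) (weakGrad U u x)) 2 (lebOn U) +
        eLpNorm (fun x => F x - F' x) 2 (lebOn U) := by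
    refine le_of_eq_of_le (eLpNorm_neg _ _ _) ?_
    exact eLpNorm_add_le hG.1 (hF.sub hF').1 (by norm_num)
  refine (add_le_add (mul_le_mul' le_rfl n1) (mul_le_mul' le_rfl n2)).trans (le_of_eq ?_)
  ring

end Stability

/-! ### Convergence of the leading coefficients. -/

section CoefficientConvergence

variable {d : ℕ}

lemma norm_matVec_le (M : Matrix (Fin d) (Fin d) ℝ) (v : Euc d) :
    ‖matVec M v‖ ≤ (∑ i, ∑ j, |M i j|) * ‖v‖ := by
  have h1 : ‖matVec M v‖ ≤ ∑ i, |matVec M v i| := by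
    rw [EuclideanSpace.norm_eq]
    refine Real.sqrt_le_iff.2 ⟨Finset.sum_nonneg fun _ _ => abs_nonneg _, ?_⟩
    simp only [Real.norm_eq_abs]
    exact Finset.sum_sq_le_sq_sum_of_nonneg fun _ _ => abs_nonneg _
  refine h1.trans ?_
  rw [Finset.sum_mul]
  refine Finset.sum_le_sum fun i _ => ?_
  rw [matVec_apply, Finset.sum_mul]
  refine (Finset.abs_sum_le_sum_abs _ _).trans (Finset.sum_le_sum fun j _ => ?_)
  rw [abs_mul]
  exact mul_le_mul_of_nonneg_left (PiLp.norm_apply_le v j) (abs_nonneg _)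

/-- Dominated convergence: the a.e. limit inherits the entrywise bound $M$, so $2d^2M|g|$ is a
majorant. Uniform convergence of the matrices is not needed. -/
lemma tendsto_eLpNorm_matVec_sub {μ : Measure (Euc d)} {A : Euc d → Matrix (Fin d) (Fin d) ℝ}
    {An : ℕ → Euc d → Matrix (Fin d) (Fin d) ℝ} {g : Euc d → Euc d} {M : ℝ}
    (hA : ∀ i j, MemLp (fun x => A x i j) ∞ μ)
    (hAn : ∀ n i j, MemLp (fun x => An n x i j) ∞ μ) (hg : MemLp g 2 μ) (hM : 0 < M)
    (hbd : ∀ n i j, eLpNorm (fun x => An n x i j) ∞ μ ≤ ENNReal.ofReal M)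
    (hlim : ∀ i j, ∀ᵐ x ∂μ, Tendsto (fun n => An n x i j) atTop (𝓝 (A x i j))) :
    Tendsto (fun n => eLpNorm (fun x => matVec (An n x - A x) (g x)) 2 μ) atTop (𝓝 0) := by
  have hbd' : ∀ᵐ x ∂μ, ∀ n i j, |An n x i j| ≤ M := by
    simp only [ae_all_iff]
    intro n i j
    filter_upwards [ae_le_eLpNormEssSup (f := fun x => An n x i j) (μ := μ)] with x hx
    have h1 := hx.trans (hbd n i j)
    rw [← ofReal_norm] at h1
    exact (ENNReal.ofReal_le_ofReal_iff hM.le).1 h1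
  have hlim' : ∀ᵐ x ∂μ, ∀ i j, Tendsto (fun n => An n x i j) atTop (𝓝 (A x i j)) := by
    simp only [ae_all_iff]
    exact hlim
  have hmem : ∀ n, MemLp (fun x => matVec (An n x - A x) (g x)) 2 μ := fun n =>
    memLp_matVec (fun i j => (hAn n i j).sub (hA i j)) hg
  have hsq : Tendsto (fun n => ∫⁻ x, ‖matVec (An n x - A x) (g x)‖ₑ ^ 2 ∂μ) atTop
      (𝓝 (∫⁻ _, 0 ∂μ)) := by
    have hKg : MemLp (fun x => (∑ _i : Fin d, ∑ _j : Fin d, 2 * M) * ‖g x‖) 2 μ :=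
      hg.norm.const_mul _
    refine tendsto_lintegral_of_dominated_convergence'
      (fun x => ‖(∑ _i : Fin d, ∑ _j : Fin d, 2 * M) * ‖g x‖‖ₑ ^ 2)
      (fun n => (hmem n).1.enorm.pow_const 2) ?_ ?_ ?_
    · intro n
      filter_upwards [hbd', hlim'] with x hx hlx
      have h2 : ‖matVec (An n x - A x) (g x)‖ ≤
          ‖(∑ _i : Fin d, ∑ _j : Fin d, 2 * M) * ‖g x‖‖ := by
        refine (norm_matVec_le _ _).trans (le_trans ?_ (le_abs_self _))
        refine mul_le_mul_of_nonneg_right ?_ (norm_nonneg _)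
        refine Finset.sum_le_sum fun i _ => Finset.sum_le_sum fun j _ => ?_
        have h3 : |A x i j| ≤ M := le_of_tendsto' (hlx i j).abs fun k => hx k i j
        have h4 := abs_sub (An n x i j) (A x i j)
        rw [Matrix.sub_apply]
        linarith [hx n i j]
      gcongr
      exact enorm_le_iff_norm_le.2 h2
    · rw [← eLpNorm_two_sq]
      exact ENNReal.pow_ne_top hKg.2.ne
    · filter_upwards [hlim'] with x hlx
      have h5 : Tendsto (fun n => (∑ i, ∑ j, |(An n x - A x) i j|) * ‖g x‖) atTop (𝓝 0) := by
        have h6 : Tendsto (fun n => ∑ i, ∑ j, |(An n x - A x) i j|) atTop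
            (𝓝 (∑ i : Fin d, ∑ j : Fin d, |(0 : ℝ)|)) := by
          refine tendsto_finsetSum _ fun i _ => tendsto_finsetSum _ fun j _ => ?_
          have := ((hlx i j).sub_const (A x i j)).abs
          rwa [sub_self] at this
        simpa using h6.mul_const ‖g x‖
      have h7 : Tendsto (fun n => matVec (An n x - A x) (g x)) atTop (𝓝 0) :=
        squeeze_zero_norm (fun n => norm_matVec_le _ _) h5
      have h8 := (ENNReal.continuous_pow 2).tendsto 0 |>.comp
        ((tendsto_zero_iff_enorm_tendsto_zero).1 h7)
      simpa [Function.comp_def] using h8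
  rw [lintegral_zero] at hsq
  have h9 := (ENNReal.continuous_rpow_const (y := (1 / 2 : ℝ))).tendsto 0 |>.comp hsq
  rw [ENNReal.zero_rpow_of_pos (by norm_num)] at h9
  refine h9.congr fun n => ?_
  rw [Function.comp_apply, ← eLpNorm_two_sq, ← ENNReal.rpow_natCast, ← ENNReal.rpow_mul]
  norm_num

end CoefficientConvergence

/-! ### Conclusion. -/

lemma constN_nonneg {d : ℕ} {p : ℝ} (hp : IsTwoLowerStar d p) (V : ℝ≥0) : 0 ≤ constN d p V := by
  rw [constN]
  split_ifs with h
  · have : (3 : ℝ) ≤ d := by exact_mod_cast h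
    exact div_nonneg (by linarith) (by linarith)
  · have := hp.two_le_conj
    exact mul_nonneg (by linarith) (Real.rpow_nonneg V.2 _)

/-- For $d=2$ the constant contains a power of $V$, so positivity needs $V\ne0$. -/
lemma constN_pos {d : ℕ} {p : ℝ} (hp : IsTwoLowerStar d p) {V : ℝ≥0} (hV : V ≠ 0) :
    0 < constN d p V := by
  rw [constN]
  split_ifs with h
  · have : (3 : ℝ) ≤ d := by exact_mod_cast h
    exact div_pos (by linarith) (by linarith)
  · have := hp.two_le_conj
    exact mul_pos (by linarith) (Real.rpow_pos_of_pos (NNReal.coe_pos.2 (pos_iff_ne_zero.2 hV)) _)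

theorem corollary1p2 (d : ℕ) (p lam : ℝ) (V : ℝ≥0) (hp : IsTwoLowerStar d p) (hlam : 0 < lam) :
    ∃ C₁ : ℝ, 0 < C₁ ∧ IsEnergyConst d p lam V C₁ ∧
      ∀ (U : Set (Euc d)) (A : Euc d → Matrix (Fin d) (Fin d) ℝ) (B : Euc d → Euc d)
        (c : Euc d → ℝ) (α : ℝ) (f : Euc d → ℝ) (F : Euc d → Euc d) (u : Euc d → ℝ)
        (An : ℕ → Euc d → Matrix (Fin d) (Fin d) ℝ) (Bn : ℕ → Euc d → Euc d)
        (cn : ℕ → Euc d → ℝ) (fn : ℕ → Euc d → ℝ) (Fn : ℕ → Euc d → Euc d)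
        (un : ℕ → Euc d → ℝ),
        volume U = (V : ℝ≥0∞) → 0 < α →
        Admissible lam p U A B c → MemLp f 1 (lebOn U) → MemLp F 2 (lebOn U) →
        IsWeakSol U A B c α f F u →
        (∀ n, Admissible lam p U (An n) (Bn n) (cn n)) →
        (∀ n, MemLp (fn n) 1 (lebOn U)) → (∀ n, MemLp (Fn n) 2 (lebOn U)) →
        (∀ n, IsWeakSol U (An n) (Bn n) (cn n) α (fn n) (Fn n) (un n)) →
        (∀ n, eLpNorm (fun x => un n x - u x) 1 (lebOn U) ≤
          ENNReal.ofReal α⁻¹ *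
              (ENNReal.ofReal C₁ *
                (eLpNorm f (ENNReal.ofReal p) (lebOn U) + eLpNorm F 2 (lebOn U))) *
              (eLpNorm (fun x => B x - Bn n x) 2 (lebOn U) +
                ENNReal.ofReal (constN d p V) *
                  eLpNorm (fun x => c x - cn n x) (ENNReal.ofReal p) (lebOn U)) +
            ENNReal.ofReal ((V : ℝ) ^ (1 / 2 : ℝ) * C₁) *
              eLpNorm (fun x => matVec (An n x - A x) (weakGrad U u x)) 2 (lebOn U) +
            ENNReal.ofReal α⁻¹ * eLpNorm (fun x => f x - fn n x) 1 (lebOn U) +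
            ENNReal.ofReal ((V : ℝ) ^ (1 / 2 : ℝ) * C₁) *
              eLpNorm (fun x => F x - Fn n x) 2 (lebOn U)) ∧
        ((∃ M : ℝ, 0 < M ∧
            ∀ n i j, eLpNorm (fun x => An n x i j) ∞ (lebOn U) ≤ ENNReal.ofReal M) →
          (∀ i j, ∀ᵐ x ∂(lebOn U), Tendsto (fun n => An n x i j) atTop (𝓝 (A x i j))) →
          Tendsto (fun n => eLpNorm (fun x => Bn n x - B x) 2 (lebOn U)) atTop (𝓝 0) →
          Tendsto (fun n => eLpNorm (fun x => Fn n x - F x) 2 (lebOn U)) atTop (𝓝 0) →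
          Tendsto (fun n => eLpNorm (fun x => cn n x - c x) (ENNReal.ofReal p) (lebOn U))
            atTop (𝓝 0) →
          Tendsto (fun n => eLpNorm (fun x => fn n x - f x) 1 (lebOn U)) atTop (𝓝 0) →
          Tendsto (fun n => eLpNorm (fun x => un n x - u x) 1 (lebOn U)) atTop (𝓝 0)) := by
  obtain ⟨C₁, hC0, hC, hCq⟩ := exists_energyConst hp hlam (constN_nonneg hp V) (constN_pos hp)
  obtain ⟨S, hS⟩ := exists_sobolev hp V
  refine ⟨C₁, hC0, hC, ?_⟩
  intro U A B c α f F u An Bn cn fn Fn un hV hα hA hf hF hsol hAn hfn hFn hsoln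
  have hu := hsol.memH12Zero.memH12
  have huq : MemLp u (ENNReal.ofReal (p / (p - 1))) (lebOn U) :=
    ⟨hu.memLp.1, (hS U _ hV hA.isOpen hsol.memH12Zero).trans_lt
      (ENNReal.mul_lt_top ENNReal.coe_lt_top hu.grad_memLp.2)⟩
  have hdir := fun n => hsol.eLpNorm_sub_le hp hlam hα hC hV hA hf hF (hAn n) (hfn n) (hFn n)
    (hsoln n) huq
  refine ⟨fun n => ?_, ?_⟩
  -- On a null set all norms vanish; otherwise $N>0$.
  · rcases eq_or_ne V 0 with rfl | hV0
    · have : lebOn U = 0 := Measure.restrict_eq_zero.2 (by simpa using hV)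
      simp [this]
    have hN := constN_pos hp hV0
    refine (hdir n).trans ?_
    gcongr ?_ + _ + _ + _
    rw [mul_assoc]
    refine mul_le_mul' le_rfl ?_
    set X := eLpNorm (fun x => B x - Bn n x) 2 (lebOn U)
    set Y := eLpNorm (fun x => c x - cn n x) (ENNReal.ofReal p) (lebOn U)
    by_cases hfp : MemLp f (ENNReal.ofReal p) (lebOn U)
    · have h1 := (eLpNorm_weakGrad_le_normH12 hu.grad_memLp.1).trans
        (hC U A B c α f F u hV hA hα.le hfp hF hsol)
      have h2 := hCq U A B c α f F u hV0 hV hA hα.le hfp hF hsol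
      refine (add_le_add (mul_le_mul' (le_refl X) h1) (mul_le_mul' (le_refl Y) h2)).trans
        (le_of_eq ?_)
      ring
    -- Here $C_4=\infty$. If the bracket it multiplies is nonzero, the right side is infinite;
    -- otherwise $N>0$ forces both coefficient differences to vanish, and $\infty\cdot0=0$ is
    -- consistent with the direct estimate.
    · have htop : eLpNorm f (ENNReal.ofReal p) (lebOn U) = ⊤ := by
        by_contra h
        exact hfp ⟨hf.1, lt_top_iff_ne_top.2 h⟩
      rw [htop, top_add, ENNReal.mul_top (by simpa using hC0)]
      rcases eq_or_ne (X + ENNReal.ofReal (constN d p V) * Y) 0 with h0 | h0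
      · rw [add_eq_zero, mul_eq_zero] at h0
        have hY : Y = 0 := h0.2.resolve_left (by simpa using hN)
        rw [h0.1, hY]
        simp
      · rw [ENNReal.top_mul h0]
        exact le_top
  -- Convergence comes from `hdir`, where $\|\nabla u\|_{L^2}$ and $\|u\|_{L^{2^*}}$, finite for
  -- every $f\in L^1$, replace $C_4$.
  · rintro ⟨M, hM, hbd⟩ hAlim hBlim hFlim hclim hflim
    have hAconv := tendsto_eLpNorm_matVec_sub hA.A_memLp (fun n => (hAn n).A_memLp) hu.grad_memLp
      hM hbd hAlim
    have hswap : ∀ {E : Type} [NormedAddCommGroup E] {r : ℝ≥0∞} {h : Euc d → E}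
        {hn : ℕ → Euc d → E},
        Tendsto (fun n => eLpNorm (fun x => hn n x - h x) r (lebOn U)) atTop (𝓝 0) →
        Tendsto (fun n => eLpNorm (fun x => h x - hn n x) r (lebOn U)) atTop (𝓝 0) := by
      intro E _ r h hn hlim
      exact hlim.congr fun n => eLpNorm_sub_comm _ _ _ _
    have t1 := ENNReal.Tendsto.mul_const (hswap hBlim) (Or.inr hu.grad_memLp.2.ne)
    have t2 := ENNReal.Tendsto.mul_const (hswap hclim) (Or.inr huq.2.ne)
    have hmul : ∀ (a : ℝ) {h : ℕ → ℝ≥0∞}, Tendsto h atTop (𝓝 0) →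
        Tendsto (fun n => ENNReal.ofReal a * h n) atTop (𝓝 0) := by
      intro a h hlim
      simpa using ENNReal.Tendsto.const_mul (a := ENNReal.ofReal a) hlim
        (Or.inr ENNReal.ofReal_ne_top)
    have t3 := t1.add t2
    rw [zero_mul, zero_mul, add_zero] at t3
    have t4 := (((hmul α⁻¹ t3).add (hmul ((V : ℝ) ^ (1 / 2 : ℝ) * C₁) hAconv)).add
      (hmul α⁻¹ (hswap hflim))).add (hmul ((V : ℝ) ^ (1 / 2 : ℝ) * C₁) (hswap hFlim))
    rw [add_zero, add_zero, add_zero] at t4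
    exact tendsto_of_tendsto_of_tendsto_of_le_of_le tendsto_const_nhds t4 (fun _ => zero_le) hdir
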